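/- Let $\Sigma=\{0,1\}$ and let $\Sigma^*$ be the set of non-empty finite strings over $\Sigma$. A promise problem is a map $\phi$ from $\Sigma^*$ to the set $\{\{0\},\{1\},\Sigma\}$ of non-empty subsets of $\Sigma$; its dual $\lnot\phi$ is given by $(\lnot\phi)(s)=\{1-b : b\in\phi(s)\}$. Write $\phi_1\propto\phi_2$ (strong reduction) if there is $\mu:\Sigma^*\to\Sigma^*$, computable by a Turing machine in time polynomial in the length of the input, with $\phi_1(s)\supseteq\phi_2(\mu(s))$ for all $s\in\Sigma^*$; write $[\phi]=\{\psi : \psi\propto\phi\}$ and $\lnot[\phi]=[\lnot\phi]$. Functions $f:\Sigma^m\to\Sigma$ and $f:\Sigma^m\times\Sigma^{m'}\to\Sigma$ with $m\ge 1$, $m'\ge 0$ are encoded as strings by the numbers $m$ (and $m'$) in unary followed by a Boolean expression for $f$ with the operators $\land,\lor,\lnot$, written in prefix notation with the variables numbered in unary. Let $\mathrm{SAT}(f)=\{1\}$ if $f(x)=1$ for some $x$, and $\{0\}$ otherwise. Let $\mathrm{MaxVAL}(f)=\{x_1\}$, where $x$ is the lexicographically greatest string with $f(x)=1$ ($x_1$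 being the most significant bit), if there is an $x$ with $f(x)=1$, and $\mathrm{MaxVAL}(f)=\Sigma$ otherwise. Let $\mathrm{UVAL}_2(f)=\{x_1\}$ if there is exactly one $x$ such that $f(x,y)=1$ for all $y$, this $x$ being meant, and $\mathrm{UVAL}_2(f)=\Sigma$ otherwise. A string that encodes no function has the value $\{0\}$ under $\mathrm{SAT}$, and $\Sigma$ under $\mathrm{MaxVAL}$ and $\mathrm{UVAL}_2$. Theorem. (i) $\lnot[\mathrm{UVAL}_2]=[\mathrm{UVAL}_2]$. (ii) $\mathrm{MaxVAL}\propto\mathrm{UVAL}_2$. More precisely, there is a strong reduction $\mu$ of $\mathrm{MaxVAL}$ to $\mathrm{UVAL}_2$ that maps every code of an $f:\Sigma^m\to\Sigma$ to a code of the function $g:\Sigma^m\times\Sigma^{m(m-1)/2}\to\Sigma$ given by $$g(x,y)=f(x)\land\bigwedge_{i=1}^m\bigl(x_i\lor\lnot f(x_1,\ldots,x_{i-1},1,y_{i,i+1},\ldots,y_{i,m})\bigr),$$ where the bits of $y$ are indexed, in some order depending only on $m$, by the pairs $(i,j)$ with $1\le i<j\le m$; and for every $x\in\Sigma^m$, $g(x,y)=1$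 holds for all $y$ if and only if $x$ is the lexicographically greatest string with $f(x)=1$. (iii) $\mathrm{SAT}\propto\mathrm{UVAL}_2$. -/

import Mathlib

namespace PromiseHierarchy

/-- The set of finite non-empty strings over the alphabet `{0, 1}`. -/
abbrev Str : Type := {s : List Bool // s ≠ []}

/-- The non-empty subsets of `{0, 1}`: the possible sets of valid answers. -/
abbrev Answers : Type := {S : Set Bool // S.Nonempty}

/-- The answer set `{0, 1}`, for which every answer is valid. -/
def anyAnswer : Answers := ⟨Set.univ, Set.univ_nonempty⟩

/-- The answer set `{b}`. -/
def onlyAnswer (b : Bool) : Answers := ⟨{b}, Set.singleton_nonempty b⟩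

/-- Negation of answer sets: `{0} ↦ {1}`, `{1} ↦ {0}`, `{0, 1} ↦ {0, 1}`. -/
def Answers.neg (S : Answers) : Answers :=
  ⟨(fun b : Bool => !b) '' S.1, S.2.image _⟩

/-- The answer set that is `S` if the promise `P` holds, and `{0, 1}` otherwise. -/
def promise (P : Prop) (S : Set Bool) (h : P → S.Nonempty) : Answers :=
  ⟨{b | P → b ∈ S}, by
    by_cases hP : P
    · obtain ⟨b, hb⟩ := h hP
      exact ⟨b, fun _ => hb⟩
    · exact ⟨true, fun hP' => absurd hP' hP⟩⟩

/-- A promise problem assigns to every string its non-empty set of valid answers. -/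
abbrev PromiseProblem : Type := Str → Answers

/-- The dual promise problem. -/
def dual (φ : PromiseProblem) : PromiseProblem := fun s => (φ s).neg

/-- `μ` is computed by a Turing machine in time polynomial in the length of the input. -/
def PolyTime (μ : Str → Str) : Prop :=
  Nonempty (Turing.TM2ComputableInPolyTime
    (Subtype.val : Str → List Bool) (Subtype.val : Str → List Bool) μ)

/-- `μ` is a strong (many-one, Karp) reduction of `φ₁` to `φ₂`. -/
def IsStrongReduction (μ : Str → Str) (φ₁ φ₂ : PromiseProblem) : Prop :=
  PolyTime μ ∧ ∀ s, (φ₂ (μ s)).1 ⊆ (φ₁ s).1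

/-- Strong reducibility. -/
def StronglyReduces (φ₁ φ₂ : PromiseProblem) : Prop :=
  ∃ μ : Str → Str, IsStrongReduction μ φ₁ φ₂

infix:50 " ∝ " => StronglyReduces

/-- The strong closure of `φ₂`: all promise problems that strongly reduce to it. -/
def strongClosure (φ₂ : PromiseProblem) : Set PromiseProblem := {φ₁ | φ₁ ∝ φ₂}

/-- Boolean expressions in variables indexed by `V`. -/
inductive BExpr (V : Type) : Type
  | var (v : V) : BExpr V
  | not (e : BExpr V) : BExpr V
  | and (e₁ e₂ : BExpr V) : BExpr V
  | or (e₁ e₂ : BExpr V) : BExpr V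

/-- The Boolean function denoted by an expression. -/
def BExpr.eval {V : Type} : BExpr V → (V → Bool) → Bool
  | .var v, a => a v
  | .not e, a => !(e.eval a)
  | .and e₁ e₂, a => e₁.eval a && e₂.eval a
  | .or e₁ e₂, a => e₁.eval a || e₂.eval a

/-- The number `k` in self-delimiting unary: `k` ones and a zero. -/
def unary (k : ℕ) : List Bool := List.replicate k true ++ [false]

/-- Expressions as bit strings, in prefix notation; `num v` is the number of the variable `v`. -/
def BExpr.bits {V : Type} (num : V → ℕ) : BExpr V → List Bool
  | .var v => false :: false :: unary (num v)
  | .not e => false :: true :: e.bits num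
  | .and e₁ e₂ => true :: false :: (e₁.bits num ++ e₂.bits num)
  | .or e₁ e₂ => true :: true :: (e₁.bits num ++ e₂.bits num)

theorem unary_append_inj {k l : ℕ} {s t : List Bool} (h : unary k ++ s = unary l ++ t) :
    k = l ∧ s = t := by
  induction k generalizing l with
  | zero => cases l <;> simp_all [unary, List.replicate_succ]
  | succ k ih =>
    cases l with
    | zero => simp [unary, List.replicate_succ] at h
    | succ l =>
      have h' : unary k ++ s = unary l ++ t := by
        simpa [unary, List.replicate_succ] using h
      exact ⟨congrArg _ (ih h').1, (ih h').2⟩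

theorem BExpr.bits_append_inj {V : Type} {num : V → ℕ} (hn : Function.Injective num)
    {e e' : BExpr V} {s t : List Bool} (h : e.bits num ++ s = e'.bits num ++ t) :
    e = e' ∧ s = t := by
  induction e generalizing e' s t with
  | var v =>
    cases e' <;> simp only [bits, List.cons_append, List.cons.injEq, reduceCtorEq, false_and,
      and_false, true_and] at h
    obtain ⟨h1, h2⟩ := unary_append_inj h
    exact ⟨congrArg _ (hn h1), h2⟩
  | not e ih =>
    cases e' <;> simp only [bits, List.cons_append, List.cons.injEq, reduceCtorEq, false_and,
      and_false, true_and] at h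
    obtain ⟨h1, h2⟩ := ih h
    exact ⟨congrArg _ h1, h2⟩
  | and e₁ e₂ ih₁ ih₂ =>
    cases e' <;> simp only [bits, List.cons_append, List.cons.injEq, reduceCtorEq, false_and,
      and_false, true_and, List.append_assoc] at h
    obtain ⟨h1, h2⟩ := ih₁ h
    obtain ⟨h3, h4⟩ := ih₂ h2
    exact ⟨by rw [h1, h3], h4⟩
  | or e₁ e₂ ih₁ ih₂ =>
    cases e' <;> simp only [bits, List.cons_append, List.cons.injEq, reduceCtorEq, false_and,
      and_false, true_and, List.append_assoc] at h
    obtain ⟨h1, h2⟩ := ih₁ h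
    obtain ⟨h3, h4⟩ := ih₂ h2
    exact ⟨by rw [h1, h3], h4⟩

/-- An instance of a level 1 problem: an expression for `f(x)` with `x` of length `m ≥ 1`. -/
structure Inst₁ : Type where
  (m : ℕ)
  (pos : 0 < m)
  (f : BExpr (Fin m))

/-- An instance of a level 2 problem: an expression for `f(x, y)` with `x` of length `m ≥ 1`
and `y` of length `m' ≥ 0`. -/
structure Inst₂ : Type where
  (m : ℕ)
  (m' : ℕ)
  (pos : 0 < m)
  (f : BExpr (Fin m ⊕ Fin m'))

/-- The code of an instance: `m` in unary, then the expression. -/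
def Inst₁.code (I : Inst₁) : Str :=
  ⟨unary I.m ++ I.f.bits (fun i : Fin I.m => (i : ℕ)), by simp [unary]⟩

/-- The variables of `f(x, y)` are numbered with those of `x` first. -/
def num₂ (m m' : ℕ) : Fin m ⊕ Fin m' → ℕ :=
  Sum.elim (fun i => (i : ℕ)) (fun j => m + (j : ℕ))

/-- The code of an instance: `m` and `m'` in unary, then the expression. -/
def Inst₂.code (I : Inst₂) : Str :=
  ⟨unary I.m ++ (unary I.m' ++ I.f.bits (num₂ I.m I.m')), by simp [unary]⟩

theorem BExpr.bits_injective {V : Type} {num : V → ℕ} (hn : Function.Injective num) :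
    Function.Injective (BExpr.bits num) := fun e e' h =>
  (BExpr.bits_append_inj (e := e) (e' := e') (s := []) (t := []) hn (by rw [h])).1

theorem Inst₁.code_injective : Function.Injective Inst₁.code := by
  rintro ⟨m, hm, f⟩ ⟨n, hn, g⟩ h
  obtain ⟨rfl, h2⟩ := unary_append_inj (congrArg Subtype.val h)
  obtain rfl := BExpr.bits_injective (Fin.val_injective (n := m)) h2
  rfl

theorem num₂_injective (m m' : ℕ) : Function.Injective (num₂ m m') := by
  rintro (⟨i, hi⟩ | ⟨i, hi⟩) (⟨j, hj⟩ | ⟨j, hj⟩) h <;>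
    simp only [num₂, Sum.elim_inl, Sum.elim_inr] at h <;> first | omega | (simp; omega)

theorem Inst₂.code_injective : Function.Injective Inst₂.code := by
  rintro ⟨m, m', hm, f⟩ ⟨n, n', hn, g⟩ h
  obtain ⟨rfl, h2⟩ := unary_append_inj (congrArg Subtype.val h)
  obtain ⟨rfl, h3⟩ := unary_append_inj h2
  obtain rfl := BExpr.bits_injective (num₂_injective m m') h3
  rfl

/-- `x` is the lexicographically greatest string with `f(x) = 1` (the first bit is the most
significant). -/
def IsMaxSat {m : ℕ} (f : (Fin m → Bool) → Bool) (x : Fin m → Bool) : Prop :=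
  IsGreatest {z : Lex (Fin m → Bool) | f (ofLex z) = true} (toLex x)

theorem exists_isMaxSat {m : ℕ} {f : (Fin m → Bool) → Bool} (h : ∃ x, f x = true) :
    ∃ x, IsMaxSat f x := by
  obtain ⟨x, hx⟩ := h
  obtain ⟨z, hz, hz'⟩ := Set.exists_max_image
    {z : Lex (Fin m → Bool) | f (ofLex z) = true} id
    (Set.Finite.subset (Set.finite_univ (α := Fin m → Bool)) (fun _ _ => trivial))
    ⟨toLex x, hx⟩
  exact ⟨ofLex z, hz, hz'⟩

/-- The first bit of the greatest `x` with `f(x) = 1`, on the promise that there is some `x`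
with `f(x) = 1`. -/
def maxVal {m : ℕ} (hm : 0 < m) (f : (Fin m → Bool) → Bool) : Answers :=
  promise (∃ x, f x = true) {b | ∃ x, IsMaxSat f x ∧ x ⟨0, hm⟩ = b} (fun h =>
    let ⟨x, hx⟩ := exists_isMaxSat h
    ⟨x ⟨0, hm⟩, x, hx, rfl⟩)

/-- The first bit of the unique `x` such that `f(x, y) = 1` for all `y`, on the promise that
there is exactly one such `x`. -/
def uval₂ {m m' : ℕ} (hm : 0 < m) (f : (Fin m → Bool) → (Fin m' → Bool) → Bool) : Answers :=
  promise (∃! x, ∀ y, f x y = true) {b | ∃ x, (∀ y, f x y = true) ∧ x ⟨0, hm⟩ = b} (fun h =>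
    let ⟨x, hx, _⟩ := h
    ⟨x ⟨0, hm⟩, x, hx, rfl⟩)

open Classical in
/-- The (non-promise) satisfiability problem; a string that is not a code gets the answer `0`. -/
noncomputable def SAT : PromiseProblem :=
  Function.extend Inst₁.code (fun I => onlyAnswer (decide (∃ x, I.f.eval x = true)))
    (fun _ => onlyAnswer false)

/-- `MaxVAL`; for a string that is not a code nothing is promised. -/
noncomputable def MaxVAL : PromiseProblem :=
  Function.extend Inst₁.code (fun I => maxVal I.pos I.f.eval) (fun _ => anyAnswer)

/-- `UVAL₂`; for a string that is not a code nothing is promised. -/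
noncomputable def UVAL₂ : PromiseProblem :=
  Function.extend Inst₂.code (fun I => uval₂ I.pos (fun x y => I.f.eval (Sum.elim x y)))
    (fun _ => anyAnswer)

theorem MaxVAL_code (I : Inst₁) : MaxVAL I.code = maxVal I.pos I.f.eval :=
  Inst₁.code_injective.extend_apply _ _ I

theorem UVAL₂_code (I : Inst₂) :
    UVAL₂ I.code = uval₂ I.pos (fun x y => I.f.eval (Sum.elim x y)) :=
  Inst₂.code_injective.extend_apply _ _ I

/-- The index set of the variables `y_{i,j}` with `i < j`. -/
abbrev Pairs (m : ℕ) : Type := {p : Fin m × Fin m // p.1 < p.2}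

/-- The string `(x_1, …, x_{i-1}, 1, y_{i,i+1}, …, y_{i,m})`. -/
def spliced {m : ℕ} (x : Fin m → Bool) (y : Pairs m → Bool) (i : Fin m) : Fin m → Bool :=
  fun j => if h : i < j then y ⟨(i, j), h⟩ else if j = i then true else x j

/-- The function
`g(x, y) = f(x) ∧ ⋀ i, (x_i ∨ ¬ f(x_1, …, x_{i-1}, 1, y_{i,i+1}, …, y_{i,m}))`. -/
def maxFormula {m : ℕ} (f : (Fin m → Bool) → Bool) (x : Fin m → Bool) (y : Pairs m → Bool) :
    Bool :=
  f x && decide (∀ i, (x i || !(f (spliced x y i))) = true)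

end PromiseHierarchy

open PromiseHierarchy

/-! Negating the first bit of `x` is an involution on the candidates `x`. Substituting it into `f`
preserves the promise of `UVAL₂` and exchanges the answers 0 and 1 (`uval₂_flip`). Hence `dual UVAL₂
∝ UVAL₂`, and dualising this reduction gives the converse.

A string exceeds `x` lexicographically iff, for some `i` with `x_i = 0`, it agrees with `x` before
`i` and has a 1 at `i`; its later bits are arbitrary. So `x` is the greatest solution of `f` iff
`f(x) = 1` and no such string is a solution. With the later bits as universally quantified variables
`y_{i,j}`, this is the formula `g` (`forall_maxFormula_iff`). A satisfiable `f` has exactly one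
greatest solution, so the promise of `MaxVAL` implies that of `UVAL₂` for `g`.

The formula `¬ b ∨ f(x)` with leading variable `b` is always satisfiable, and its greatest solution
has `b = 1` iff `f` is satisfiable (`maxVal_guard`). This reduces `SAT` to `MaxVAL`, and thus to
`UVAL₂`.

Most of the work is polynomial time on `TM2` machines. Structured programs are compiled to machine
code (`Run.iterate_step`, `computable_of_run`) and executed symbolically with a step count (`Exec`).
In prefix notation, substitution is a replacement of tokens from left to right (`BExpr.bits_bind`,
`exec_tokens`), so each of the three maps of instances is a short program. A reduction must act on
all strings: another program recognises the codes, by counting the expressions still expected, and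
replaces every other string by a fixed code (`computable_decode`). The two programs are joined by
composing machines (`computable_comp`), which needs the output of a machine to be polynomially
bounded in length. -/

namespace PromiseHierarchy

open Turing

/-! ### A structured programming language for stack machines -/

/-- The names of the stacks used by structured programs. -/
inductive Reg : Type
  | inp | out | sav | idx | len | rem | tmp | aux
  deriving DecidableEq

instance : Fintype Reg :=
  ⟨{.inp, .out, .sav, .idx, .len, .rem, .tmp, .aux}, fun k => by cases k <;> decide⟩

/-- The contents of all stacks. -/
structure Store : Type where
  (inp out sav idx len rem tmp aux : List Bool)

def Store.get (S : Store) : Reg → List Bool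
  | .inp => S.inp
  | .out => S.out
  | .sav => S.sav
  | .idx => S.idx
  | .len => S.len
  | .rem => S.rem
  | .tmp => S.tmp
  | .aux => S.aux

def Store.set (S : Store) (k : Reg) (l : List Bool) : Store :=
  match k with
  | .inp => { S with inp := l }
  | .out => { S with out := l }
  | .sav => { S with sav := l }
  | .idx => { S with idx := l }
  | .len => { S with len := l }
  | .rem => { S with rem := l }
  | .tmp => { S with tmp := l }
  | .aux => { S with aux := l }

theorem Store.get_set (S : Store) (k : Reg) (l : List Bool) :
    (S.set k l).get = Function.update S.get k l := by
  funext j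
  cases k <;> cases j <;> rfl

/-- Structured programs. The program `loop k c P` pops a symbol `o` from the stack `k`, runs
`P o`, and starts again if `c o` is true. -/
inductive Prog : Type
  | nop
  | push (k : Reg) (b : Bool)
  | seq (P Q : Prog)
  | loop (k : Reg) (c : Option Bool → Bool) (P : Option Bool → Prog)

/-- `Run P S S' t`: the program `P` started in `S` ends in `S'` after `t` steps. -/
inductive Run : Prog → Store → Store → ℕ → Prop
  | nop {S} : Run .nop S S 1
  | push {k b S} : Run (.push k b) S (S.set k (b :: S.get k)) 1
  | seq {P Q S S' S'' t t'} : Run P S S' t → Run Q S' S'' t' → Run (.seq P Q) S S'' (t + t')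
  | again {k c P S S' S'' t t'} : c (S.get k).head? = true →
      Run (P (S.get k).head?) (S.set k (S.get k).tail) S' t → Run (.loop k c P) S' S'' t' →
      Run (.loop k c P) S S'' (1 + t + t')
  | done {k c P S S' t} : c (S.get k).head? = false →
      Run (P (S.get k).head?) (S.set k (S.get k).tail) S' t → Run (.loop k c P) S S' (1 + t)

/-- The labels of the machine that executes a program. -/
def Prog.Lab : Prog → Type
  | .nop => Unit
  | .push _ _ => Unit
  | .seq P Q => P.Lab ⊕ Q.Lab
  -- There is one copy of the body for each possible result of the pop, so the label remembers `o`;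
  -- the state of the machine may be overwritten in the body.
  | .loop _ _ P => Option (Σ o : Option Bool, (P o).Lab)

noncomputable instance Prog.fintypeLab (P : Prog) : Fintype P.Lab := by
  induction P with
  | nop => exact inferInstanceAs (Fintype Unit)
  | push => exact inferInstanceAs (Fintype Unit)
  | seq P Q ihP ihQ => exact inferInstanceAs (Fintype (P.Lab ⊕ Q.Lab))
  | loop k c P ih => exact inferInstanceAs (Fintype (Option (Σ o : Option Bool, (P o).Lab)))

/-- The label at which the execution of a program starts. -/
def Prog.entry : (P : Prog) → P.Lab
  | .nop => ()
  | .push _ _ => ()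
  | .seq P _ => .inl P.entry
  | .loop _ _ _ => none

/-- The machine code of a program whose labels are embedded by `emb` into those of a machine, and
that leaves the program through the label `ex`. -/
def Prog.stmt {Λ : Type} : (P : Prog) → (P.Lab → Λ) → Λ → P.Lab →
    TM2.Stmt (fun _ : Reg => Bool) Λ (Option Bool)
  | .nop, _, ex, _ => .goto fun _ => ex
  | .push k b, _, ex, _ => .push k (fun _ => b) (.goto fun _ => ex)
  | .seq P Q, emb, _, .inl l => P.stmt (fun l => emb (.inl l)) (emb (.inr Q.entry)) l
  | .seq _ Q, emb, ex, .inr l => Q.stmt (fun l => emb (.inr l)) ex l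
  | .loop k _ P, emb, _, none => .pop k (fun _ o => o) (.goto fun v => emb (some ⟨v, (P v).entry⟩))
  | .loop _ c P, emb, ex, some ⟨o, l⟩ =>
    (P o).stmt (fun l => emb (some ⟨o, l⟩)) (cond (c o) (emb none) ex) l

theorem iterate_bind_add {α : Type*} {f : α → Option α} {a b c : Option α} {s t : ℕ}
    (h₁ : (flip bind f)^[s] a = b) (h₂ : (flip bind f)^[t] b = c) :
    (flip bind f)^[s + t] a = c := by
  rw [add_comm, Function.iterate_add_apply, h₁, h₂]

/-- Induction on the run. Only the labels in the range of `emb` are required to carry the code of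
`P`, so the same machine `M` serves for all subprograms. The state `v` is arbitrary since it is read
only directly after a pop has set it. -/
theorem Run.iterate_step {P : Prog} {S S' : Store} {t : ℕ} (h : Run P S S' t) {Λ : Type}
    {M : Λ → TM2.Stmt (fun _ : Reg => Bool) Λ (Option Bool)} {emb : P.Lab → Λ} {ex : Λ}
    (hM : ∀ l, M (emb l) = P.stmt emb ex l) (v : Option Bool) :
    ∃ v', (flip bind (TM2.step M))^[t] (some ⟨some (emb P.entry), v, S.get⟩) =
      some ⟨some ex, v', S'.get⟩ := by
  induction h generalizing ex v with
  | nop =>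
    refine ⟨v, ?_⟩
    simp [flip, TM2.step, hM, Prog.stmt]
  | @push k b S =>
    refine ⟨v, ?_⟩
    simp [flip, TM2.step, hM, Prog.stmt, Store.get_set]
  | seq h₁ h₂ ih₁ ih₂ =>
    obtain ⟨v₁, e₁⟩ := ih₁ (emb := fun l => emb (.inl l)) (fun l => hM (.inl l)) v
    obtain ⟨v₂, e₂⟩ := ih₂ (emb := fun l => emb (.inr l)) (fun l => hM (.inr l)) v₁
    exact ⟨v₂, iterate_bind_add e₁ e₂⟩
  | @again k c P S S' S'' t t' hc h₁ h₂ ih₁ ih₂ =>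
    obtain ⟨v₁, e₁⟩ := ih₁ (emb := fun l => emb (some ⟨_, l⟩)) (fun l => hM (some ⟨_, l⟩))
      (S.get k).head?
    obtain ⟨v₂, e₂⟩ := ih₂ hM v₁
    -- The exit of this copy of the body is the head of the loop.
    rw [hc, cond_true] at e₁
    refine ⟨v₂, iterate_bind_add (iterate_bind_add (s := 1) ?_ e₁) e₂⟩
    have hM₀ : M (emb none) =
      .pop k (fun _ o => o) (.goto fun v => emb (some ⟨v, (P v).entry⟩)) := hM none
    simp [flip, TM2.step, hM₀, Store.get_set, Prog.entry]
  | @done k c P S S' t hc h₁ ih₁ =>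
    obtain ⟨v₁, e₁⟩ := ih₁ (emb := fun l => emb (some ⟨_, l⟩)) (fun l => hM (some ⟨_, l⟩))
      (S.get k).head?
    rw [hc, cond_false] at e₁
    refine ⟨v₁, iterate_bind_add (s := 1) ?_ e₁⟩
    have hM₀ : M (emb none) =
      .pop k (fun _ o => o) (.goto fun v => emb (some ⟨v, (P v).entry⟩)) := hM none
    simp [flip, TM2.step, hM₀, Store.get_set, Prog.entry]

/-- The machine that executes a program, with `inp` as its input and output stack. -/
noncomputable def Prog.machine (P : Prog) : FinTM2 where
  K := Reg
  k₀ := .inp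
  k₁ := .inp
  Γ _ := Bool
  Λ := Option P.Lab
  main := some P.entry
  σ := Option Bool
  initialState := none
  m
  -- `haltList` demands the initial state, so the last popped symbol has to be forgotten before
  -- halting.
  | none => .load (fun _ => none) .halt
  | some l => P.stmt some none l

/-- The store with `l` in the input stack and nothing else. -/
def Store.ofInp (l : List Bool) : Store := ⟨l, [], [], [], [], [], [], []⟩

/-- The bridge from programs to machines: it remains to give a run that starts and ends with
everything but `inp` empty. The final reset and halt cost the one additional step in `p + 1`. -/
theorem computable_of_run {α β : Type} {ea : α → List Bool} {eb : β → List Bool} {f : α → β}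
    (P : Prog) (p : Polynomial ℕ)
    (h : ∀ a, ∃ t ≤ p.eval (ea a).length, Run P (.ofInp (ea a)) (.ofInp (eb (f a))) t) :
    Nonempty (TM2ComputableInPolyTime ea eb f) := by
  choose t ht hrun using h
  refine ⟨⟨⟨P.machine, Equiv.refl _, Equiv.refl _⟩, p + 1, fun a => ⟨⟨t a + 1, ?_⟩, ?_⟩⟩⟩
  · obtain ⟨v, e⟩ := (hrun a).iterate_step (M := P.machine.m) (emb := some) (ex := none)
      (fun l => rfl) none
    have e₁ : initList P.machine ((ea a).map (Equiv.refl Bool).invFun) =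
        (⟨some (some P.entry), none, (Store.ofInp (ea a)).get⟩ :
          TM2.Cfg (fun _ : Reg => Bool) (Option P.Lab) (Option Bool)) := by
      refine (congrArg (initList P.machine) (List.map_id (ea a))).trans ?_
      unfold initList
      congr 1
      funext k
      cases k <;> rfl
    have e₂ : haltList P.machine ((eb (f a)).map (Equiv.refl Bool).invFun) =
        (⟨none, none, (Store.ofInp (eb (f a))).get⟩ :
          TM2.Cfg (fun _ : Reg => Bool) (Option P.Lab) (Option Bool)) := by
      refine (congrArg (haltList P.machine) (List.map_id (eb (f a)))).trans ?_
      unfold haltList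
      congr 1
      funext k
      cases k <;> rfl
    refine iterate_bind_add (b := some ⟨some none, v, (Store.ofInp (eb (f a))).get⟩) ?_ ?_
    · exact (congrArg (fun c => (flip bind (TM2.step P.machine.m))^[t a] (some c)) e₁).trans e
    · exact Eq.symm (congrArg some e₂)
  · simpa using ht a

/-! ### Symbolic execution -/

/-- The programs in the list, run one after the other from `S`, end in `F` within `n` steps. -/
def Exec : List Prog → Store → Store → ℕ → Prop
  | [], S, F, _ => S = F
  | P :: Ks, S, F, n => ∃ S' t n', Run P S S' t ∧ Exec Ks S' F n' ∧ t + n' ≤ n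

theorem Exec.mono {Ks : List Prog} {S F : Store} {n n' : ℕ} (h : Exec Ks S F n) (hn : n ≤ n') :
    Exec Ks S F n' := by
  cases Ks with
  | nil => exact h
  | cons P Ks =>
    obtain ⟨S', t, k, h₁, h₂, h₃⟩ := h
    exact ⟨S', t, k, h₁, h₂, h₃.trans hn⟩

theorem Exec.run {P : Prog} {S F : Store} {n : ℕ} (h : Exec [P] S F n) : ∃ t ≤ n, Run P S F t := by
  obtain ⟨S', t, k, h₁, h₂, h₃⟩ := h
  cases h₂
  exact ⟨t, by omega, h₁⟩

section Exec

variable {Ks : List Prog} {S F : Store} {n : ℕ}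

/-- The rules from here on are in continuation style: the premise is about the remaining programs,
started in the new store. Applied backwards they execute a program symbolically, and the step bound
accumulates in a metavariable that is compared with the claimed bound at the end, through
`Exec.mono`. -/
theorem Exec.nil (h : S = F) : Exec [] S F 0 := h

theorem Exec.nop (h : Exec Ks S F n) : Exec (.nop :: Ks) S F (n + 1) :=
  ⟨S, 1, n, .nop, h, by omega⟩

theorem Exec.push {k : Reg} {b : Bool} (h : Exec Ks (S.set k (b :: S.get k)) F n) :
    Exec (.push k b :: Ks) S F (n + 1) :=
  ⟨_, 1, n, .push, h, by omega⟩

theorem Exec.seq {P Q : Prog} (h : Exec (P :: Q :: Ks) S F n) : Exec (.seq P Q :: Ks) S F n := by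
  obtain ⟨S', t, k, h₁, ⟨S'', t', k', h₂, h₃, h₄⟩, h₅⟩ := h
  exact ⟨S'', t + t', k', .seq h₁ h₂, h₃, by omega⟩

/-- One round of a loop. The popped symbol is an explicit argument so that `P o` and `c o` reduce by
computation. -/
theorem Exec.loop {k : Reg} {c : Option Bool → Bool} {P : Option Bool → Prog} (o : Option Bool)
    (ho : (S.get k).head? = o)
    (h : Exec (P o :: cond (c o) (.loop k c P :: Ks) Ks) (S.set k (S.get k).tail) F n) :
    Exec (.loop k c P :: Ks) S F (n + 1) := by
  subst ho
  cases hc : c (S.get k).head? with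
  | false =>
    rw [hc] at h
    obtain ⟨S', t, n', h₁, h₂, h₃⟩ := h
    exact ⟨S', 1 + t, n', .done hc h₁, h₂, by omega⟩
  | true =>
    rw [hc] at h
    obtain ⟨S', t, n', h₁, ⟨S'', t', k', h₂, h₃, h₄⟩, h₅⟩ := h
    exact ⟨S'', 1 + t + t', k', .again hc h₁ h₂, h₃, by omega⟩

end Exec

/-! ### Composition of polynomial time computable functions -/

section Composition

variable {K Λ σ : Type} [DecidableEq K] {Γ : K → Type}

/-- The number of operations in a statement, an upper bound for the number of pushed symbols. -/
def stmtSize : TM2.Stmt Γ Λ σ → ℕ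
  | .push _ _ q => stmtSize q + 1
  | .peek _ _ q => stmtSize q
  | .pop _ _ q => stmtSize q
  | .load _ q => stmtSize q
  | .branch _ q₁ q₂ => stmtSize q₁ + stmtSize q₂
  | .goto _ => 0
  | .halt => 0

theorem length_stk_stepAux_le (q : TM2.Stmt Γ Λ σ) (v : σ) (S : ∀ k, List (Γ k)) (k : K) :
    ((TM2.stepAux q v S).stk k).length ≤ (S k).length + stmtSize q := by
  induction q generalizing v S with
  | push j f q ih =>
    refine (ih _ _).trans ?_
    by_cases h : k = j
    · subst h
      simp only [Function.update_self, List.length_cons, stmtSize]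
      omega
    · simp only [Function.update_of_ne h, stmtSize]
      omega
  | peek j f q ih => exact ih _ _
  | pop j f q ih =>
    refine (ih _ _).trans ?_
    by_cases h : k = j
    · subst h
      simp only [Function.update_self, List.length_tail, stmtSize]
      omega
    · simp only [Function.update_of_ne h, stmtSize, le_refl]
  | load f q ih => exact ih _ _
  | branch f q₁ q₂ ih₁ ih₂ =>
    simp only [TM2.stepAux, stmtSize]
    cases f v
    · exact (ih₂ _ _).trans (by omega)
    · exact (ih₁ _ _).trans (by omega)
  | goto => simp [stmtSize]
  | halt => simp [stmtSize]

/-- A step pushes at most `C` symbols, so the output of a polynomial time machine has polynomial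
length. This bounds the running time of a second machine that works on this output. -/
theorem length_stk_iterate_le {M : Λ → TM2.Stmt Γ Λ σ} {C : ℕ} (hC : ∀ l, stmtSize (M l) ≤ C)
    (k : K) (t : ℕ) {c c' : TM2.Cfg Γ Λ σ}
    (h : (flip bind (TM2.step M))^[t] (some c) = some c') :
    (c'.stk k).length ≤ (c.stk k).length + C * t := by
  induction t generalizing c' with
  | zero => cases h; simp
  | succ t ih =>
    rw [Function.iterate_succ_apply'] at h
    cases hd : (flip bind (TM2.step M))^[t] (some c) with
    | none => rw [hd] at h; cases h
    | some d =>
      rw [hd] at h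
      have := ih hd
      obtain ⟨_ | l, v, S⟩ := d
      · cases h
      · have h' : TM2.stepAux (M l) v S = c' := Option.some.inj h
        subst h'
        have h₁ := length_stk_stepAux_le (M l) v S k
        have h₂ := hC l
        simp only at this
        rw [Nat.mul_succ]
        omega

end Composition

/-! ### The composed machine: first machine, transfer of its output, second machine. -/

namespace CompMachine

variable (A B : FinTM2)

/-- The stacks of the composition of two machines: those of both, and one for the transfer. -/
abbrev Stk : Type := A.K ⊕ (B.K ⊕ Unit)

/-- The stack alphabets. -/
abbrev Alph : Stk A B → Type := Sum.elim A.Γ (Sum.elim B.Γ fun _ => Bool)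

/-- The labels: those of both machines, and two for the transfer. -/
abbrev Lbl : Type := A.Λ ⊕ (B.Λ ⊕ Bool)

/-- The states: those of both machines, and the symbol that is transferred. -/
abbrev State : Type := A.σ × B.σ × Option Bool

variable {A B}

/-- The statements of the first machine. -/
def liftFst : TM2.Stmt A.Γ A.Λ A.σ → TM2.Stmt (Alph A B) (Lbl A B) (State A B)
  | .push k f q => .push (.inl k) (fun v => f v.1) (liftFst q)
  | .peek k f q => .peek (.inl k) (fun v o => (f v.1 o, v.2)) (liftFst q)
  | .pop k f q => .pop (.inl k) (fun v o => (f v.1 o, v.2)) (liftFst q)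
  | .load f q => .load (fun v => (f v.1, v.2)) (liftFst q)
  | .branch f q₁ q₂ => .branch (fun v => f v.1) (liftFst q₁) (liftFst q₂)
  | .goto f => .goto fun v => .inl (f v.1)
  | .halt => .goto fun _ => .inr (.inr false)

/-- The statements of the second machine. -/
def liftSnd : TM2.Stmt B.Γ B.Λ B.σ → TM2.Stmt (Alph A B) (Lbl A B) (State A B)
  | .push k f q => .push (.inr (.inl k)) (fun v => f v.2.1) (liftSnd q)
  | .peek k f q => .peek (.inr (.inl k)) (fun v o => (v.1, f v.2.1 o, v.2.2)) (liftSnd q)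
  | .pop k f q => .pop (.inr (.inl k)) (fun v o => (v.1, f v.2.1 o, v.2.2)) (liftSnd q)
  | .load f q => .load (fun v => (v.1, f v.2.1, v.2.2)) (liftSnd q)
  | .branch f q₁ q₂ => .branch (fun v => f v.2.1) (liftSnd q₁) (liftSnd q₂)
  | .goto f => .goto fun v => .inr (.inl (f v.2.1))
  | .halt => .halt

/-- The stacks of the composition. -/
def glue (S : ∀ k, List (A.Γ k)) (T : ∀ k, List (B.Γ k)) (l : List Bool) :
    ∀ k, List (Alph A B k)
  | .inl k => S k
  | .inr (.inl k) => T k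
  | .inr (.inr _) => l

theorem update_glue_fst (S : ∀ k, List (A.Γ k)) (T : ∀ k, List (B.Γ k)) (l : List Bool) (k : A.K)
    (s : List (A.Γ k)) :
    Function.update (β := fun k => List (Alph A B k)) (glue S T l) (.inl k) s =
      glue (Function.update S k s) T l := by
  refine Function.update_eq_iff.2 ⟨?_, ?_⟩
  · exact (Function.update_self k s S).symm
  · rintro (j | j | j) hj
    · exact (Function.update_of_ne (fun h => hj (congrArg _ h)) s S).symm
    · rfl
    · rfl

theorem update_glue_snd (S : ∀ k, List (A.Γ k)) (T : ∀ k, List (B.Γ k)) (l : List Bool) (k : B.K)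
    (s : List (B.Γ k)) :
    Function.update (β := fun k => List (Alph A B k)) (glue S T l) (.inr (.inl k)) s =
      glue S (Function.update T k s) l := by
  refine Function.update_eq_iff.2 ⟨?_, ?_⟩
  · exact (Function.update_self k s T).symm
  · rintro (j | j | j) hj
    · rfl
    · exact (Function.update_of_ne
        (fun h : j = k => hj (congrArg (fun x => Sum.inr (Sum.inl x)) h)) s T).symm
    · rfl

theorem update_glue_transfer (S : ∀ k, List (A.Γ k)) (T : ∀ k, List (B.Γ k)) (l s : List Bool) :
    Function.update (β := fun k => List (Alph A B k)) (glue S T l) (.inr (.inr ())) s =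
      glue S T s := by
  refine Function.update_eq_iff.2 ⟨rfl, ?_⟩
  rintro (j | j | j) hj
  · rfl
  · rfl
  · exact absurd rfl hj

/-- The configurations while the first machine is running. -/
def cfgFst (v₂ : B.σ) (b : Option Bool) (T : ∀ k, List (B.Γ k)) (l : List Bool)
    (c : TM2.Cfg A.Γ A.Λ A.σ) : TM2.Cfg (Alph A B) (Lbl A B) (State A B) :=
  ⟨some (c.l.elim (.inr (.inr false)) .inl), (c.var, v₂, b), glue c.stk T l⟩

/-- The configurations while the second machine is running. -/
def cfgSnd (v₁ : A.σ) (b : Option Bool) (S : ∀ k, List (A.Γ k)) (l : List Bool)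
    (c : TM2.Cfg B.Γ B.Λ B.σ) : TM2.Cfg (Alph A B) (Lbl A B) (State A B) :=
  ⟨c.l.map fun x => .inr (.inl x), (v₁, c.var, b), glue S c.stk l⟩

/-- A lifted statement acts on the components of the first machine only. Its halting becomes a jump
to the transfer, which is how `cfgFst` reads a halted configuration. -/
theorem stepAux_liftFst (q : TM2.Stmt A.Γ A.Λ A.σ) (v : A.σ) (S : ∀ k, List (A.Γ k)) (v₂ : B.σ)
    (b : Option Bool) (T : ∀ k, List (B.Γ k)) (l : List Bool) :
    TM2.stepAux (liftFst q) (v, v₂, b) (glue S T l) = cfgFst v₂ b T l (TM2.stepAux q v S) := by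
  induction q generalizing v S with
  | push k f q ih =>
    exact (congrArg (TM2.stepAux (liftFst q) _) (update_glue_fst S T l k _)).trans (ih _ _)
  | peek k f q ih =>
    simp only [liftFst, TM2.stepAux]
    exact ih _ _
  | pop k f q ih =>
    exact (congrArg (TM2.stepAux (liftFst q) _) (update_glue_fst S T l k _)).trans (ih _ _)
  | load f q ih =>
    simp only [liftFst, TM2.stepAux]
    exact ih _ _
  | branch f q₁ q₂ ih₁ ih₂ =>
    simp only [liftFst, TM2.stepAux]
    cases f v
    · exact ih₂ _ _
    · exact ih₁ _ _
  | goto f => rfl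
  | halt => rfl

theorem stepAux_liftSnd (q : TM2.Stmt B.Γ B.Λ B.σ) (v : B.σ) (T : ∀ k, List (B.Γ k)) (v₁ : A.σ)
    (b : Option Bool) (S : ∀ k, List (A.Γ k)) (l : List Bool) :
    TM2.stepAux (liftSnd q) (v₁, v, b) (glue S T l) = cfgSnd v₁ b S l (TM2.stepAux q v T) := by
  induction q generalizing v T with
  | push k f q ih =>
    exact (congrArg (TM2.stepAux (liftSnd q) _) (update_glue_snd S T l k _)).trans (ih _ _)
  | peek k f q ih =>
    simp only [liftSnd, TM2.stepAux]
    exact ih _ _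
  | pop k f q ih =>
    exact (congrArg (TM2.stepAux (liftSnd q) _) (update_glue_snd S T l k _)).trans (ih _ _)
  | load f q ih =>
    simp only [liftSnd, TM2.stepAux]
    exact ih _ _
  | branch f q₁ q₂ ih₁ ih₂ =>
    simp only [liftSnd, TM2.stepAux]
    cases f v
    · exact ih₂ _ _
    · exact ih₁ _ _
  | goto f => rfl
  | halt => rfl

/-- The code of the composed machine. -/
def code (eA : A.Γ A.k₁ → Bool) (eB : Bool → B.Γ B.k₀) :
    Lbl A B → TM2.Stmt (Alph A B) (Lbl A B) (State A B)
  | .inl x => liftFst (A.m x)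
  | .inr (.inl x) => liftSnd (B.m x)
  | .inr (.inr false) => .pop (.inl A.k₁) (fun v o => (v.1, v.2.1, o.map eA))
      (.branch (fun v => v.2.2.isSome)
        (.push (.inr (.inr ())) (fun v => v.2.2.getD false) (.goto fun _ => .inr (.inr false)))
        (.goto fun _ => .inr (.inr true)))
  | .inr (.inr true) => .pop (.inr (.inr ())) (fun v o => (v.1, v.2.1, o))
      (.branch (fun v => v.2.2.isSome)
        (.push (.inr (.inl B.k₀)) (fun v => eB (v.2.2.getD false))
          (.goto fun _ => .inr (.inr true)))
        (.goto fun _ => .inr (.inl B.main)))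

variable (eA : A.Γ A.k₁ → Bool) (eB : Bool → B.Γ B.k₀)

theorem iterate_fst (t : ℕ) {c c' : TM2.Cfg A.Γ A.Λ A.σ}
    (h : (flip bind (TM2.step A.m))^[t] (some c) = some c') (v₂ : B.σ) (b : Option Bool)
    (T : ∀ k, List (B.Γ k)) (l : List Bool) :
    (flip bind (TM2.step (code eA eB)))^[t] (some (cfgFst v₂ b T l c)) =
      some (cfgFst v₂ b T l c') := by
  induction t generalizing c' with
  | zero => cases h; rfl
  | succ t ih =>
    rw [Function.iterate_succ_apply'] at h ⊢
    cases hd : (flip bind (TM2.step A.m))^[t] (some c) with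
    | none => rw [hd] at h; cases h
    | some d =>
      rw [hd] at h
      rw [ih hd]
      obtain ⟨_ | x, v, S⟩ := d
      · cases h
      · have h' : TM2.stepAux (A.m x) v S = c' := Option.some.inj h
        subst h'
        exact congrArg some (stepAux_liftFst (A.m x) v S v₂ b T l)

theorem iterate_snd (t : ℕ) {c c' : TM2.Cfg B.Γ B.Λ B.σ}
    (h : (flip bind (TM2.step B.m))^[t] (some c) = some c') (v₁ : A.σ) (b : Option Bool)
    (S : ∀ k, List (A.Γ k)) (l : List Bool) :
    (flip bind (TM2.step (code eA eB)))^[t] (some (cfgSnd v₁ b S l c)) =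
      some (cfgSnd v₁ b S l c') := by
  induction t generalizing c' with
  | zero => cases h; rfl
  | succ t ih =>
    rw [Function.iterate_succ_apply'] at h ⊢
    cases hd : (flip bind (TM2.step B.m))^[t] (some c) with
    | none => rw [hd] at h; cases h
    | some d =>
      rw [hd] at h
      rw [ih hd]
      obtain ⟨_ | x, v, T⟩ := d
      · cases h
      · have h' : TM2.stepAux (B.m x) v T = c' := Option.some.inj h
        subst h'
        exact congrArg some (stepAux_liftSnd (B.m x) v T v₁ b S l)

/-- The stacks with content `s` in the stack `k` and nothing else. -/
abbrev single {K : Type} [DecidableEq K] {Γ : K → Type} (k : K) (s : List (Γ k)) :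
    ∀ k, List (Γ k) :=
  Function.update (fun _ => []) k s

theorem single_nil {K : Type} [DecidableEq K] {Γ : K → Type} (k : K) :
    single (Γ := Γ) k [] = fun _ => [] :=
  Function.update_eq_self k _

theorem length_single_le {K : Type} [DecidableEq K] {Γ : K → Type} (k : K) (s : List (Γ k))
    (j : K) :
    (single k s j).length ≤ s.length := by
  by_cases h : j = k
  · subst h; simp
  · simp [h]

theorem single_cons_tail {K : Type} [DecidableEq K] {Γ : K → Type} (k : K) (a : Γ k)
    (s : List (Γ k)) :
    Function.update (single k (a :: s)) k (single (Γ := Γ) k (a :: s) k).tail = single k s := by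
  simp

/-- One step moves one symbol, and one more step finds the stack empty. The order is reversed;
`iterate_transfer_in` reverses it back. -/
theorem iterate_transfer_out (s : List (A.Γ A.k₁)) (l : List Bool) (v₁ : A.σ) (v₂ : B.σ)
    (b : Option Bool) :
    (flip bind (TM2.step (code eA eB)))^[s.length + 1]
        (some ⟨some (.inr (.inr false)), (v₁, v₂, b), glue (single A.k₁ s) (fun _ => []) l⟩) =
      some ⟨some (.inr (.inr true)), (v₁, v₂, none),
        glue (fun _ => []) (fun _ => []) ((s.map eA).reverse ++ l)⟩ := by
  induction s generalizing l b with
  | nil =>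
    have h : single (Γ := A.Γ) A.k₁ [] A.k₁ = [] := Function.update_self _ _ _
    refine congrArg some ?_
    have : TM2.step (code eA eB) ⟨some (.inr (.inr false)), (v₁, v₂, b),
        glue (single A.k₁ []) (fun _ => []) l⟩ = some (TM2.stepAux
        (.branch (fun v : State A B => v.2.2.isSome)
          (.push (.inr (.inr ())) (fun v => v.2.2.getD false) (.goto fun _ => .inr (.inr false)))
          (.goto fun _ => .inr (.inr true)))
        (v₁, v₂, (single A.k₁ [] A.k₁).head?.map eA)
        (glue (Function.update (single A.k₁ []) A.k₁ (single A.k₁ [] A.k₁).tail)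
          (fun _ => []) l)) :=
      congrArg (fun S => some (TM2.stepAux _ _ S)) (update_glue_fst _ _ _ _ _)
    refine Option.some.inj (this.trans ?_)
    rw [h, List.tail_nil, single_nil, show Function.update (fun _ => []) A.k₁ [] = _ from
      single_nil (Γ := A.Γ) A.k₁]
    rfl
  | cons a s ih =>
    rw [Function.iterate_succ_apply]
    have : flip bind (TM2.step (code eA eB)) (some ⟨some (.inr (.inr false)), (v₁, v₂, b),
          glue (single A.k₁ (a :: s)) (fun _ => []) l⟩) =
        some ⟨some (.inr (.inr false)), (v₁, v₂, some (eA a)),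
          glue (single A.k₁ s) (fun _ => []) (eA a :: l)⟩ := by
      have h : single (Γ := A.Γ) A.k₁ (a :: s) A.k₁ = a :: s := Function.update_self _ _ _
      have : TM2.step (code eA eB) ⟨some (.inr (.inr false)), (v₁, v₂, b),
          glue (single A.k₁ (a :: s)) (fun _ => []) l⟩ = some (TM2.stepAux
          (.branch (fun v : State A B => v.2.2.isSome)
            (.push (.inr (.inr ())) (fun v => v.2.2.getD false) (.goto fun _ => .inr (.inr false)))
            (.goto fun _ => .inr (.inr true)))
          (v₁, v₂, (single A.k₁ (a :: s) A.k₁).head?.map eA)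
          (glue (Function.update (single A.k₁ (a :: s)) A.k₁ (single A.k₁ (a :: s) A.k₁).tail)
            (fun _ => []) l)) :=
        congrArg (fun S => some (TM2.stepAux _ _ S)) (update_glue_fst _ _ _ _ _)
      refine this.trans ?_
      rw [single_cons_tail, h]
      exact congrArg (fun S => some (⟨_, _, S⟩ : TM2.Cfg (Alph A B) (Lbl A B) (State A B)))
          (update_glue_transfer _ _ _ _)
    rw [this]
    refine (ih _ _).trans ?_
    simp

theorem iterate_transfer_in (s : List Bool) (l : List (B.Γ B.k₀)) (v₁ : A.σ) (v₂ : B.σ)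
    (b : Option Bool) :
    (flip bind (TM2.step (code eA eB)))^[s.length + 1]
        (some ⟨some (.inr (.inr true)), (v₁, v₂, b), glue (fun _ => []) (single B.k₀ l) s⟩) =
      some ⟨some (.inr (.inl B.main)), (v₁, v₂, none),
        glue (fun _ => []) (single B.k₀ ((s.map eB).reverse ++ l)) []⟩ := by
  induction s generalizing l b with
  | nil =>
    exact congrArg (fun S => some (⟨_, _, S⟩ : TM2.Cfg (Alph A B) (Lbl A B) (State A B)))
      (update_glue_transfer _ _ _ _)
  | cons a s ih =>
    rw [Function.iterate_succ_apply]
    have : flip bind (TM2.step (code eA eB)) (some ⟨some (.inr (.inr true)), (v₁, v₂, b),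
          glue (fun _ => []) (single B.k₀ l) (a :: s)⟩) =
        some ⟨some (.inr (.inr true)), (v₁, v₂, some a),
          glue (fun _ => []) (single B.k₀ (eB a :: l)) s⟩ := by
      have h : single (Γ := B.Γ) B.k₀ l B.k₀ = l := Function.update_self _ _ _
      refine (congrArg (fun S => some (TM2.stepAux _ _ S))
        (update_glue_transfer _ _ _ _)).trans ?_
      refine (congrArg (fun S => some (⟨_, _, S⟩ : TM2.Cfg (Alph A B) (Lbl A B) (State A B)))
          (update_glue_snd _ _ _ _ _)).trans ?_
      refine congrArg
        (fun S => some (⟨_, _, glue _ S _⟩ : TM2.Cfg (Alph A B) (Lbl A B) (State A B))) ?_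
      show Function.update (single B.k₀ l) B.k₀ (eB a :: single B.k₀ l B.k₀) = _
      rw [h]
      simp
    rw [this]
    refine (ih _ _).trans ?_
    simp

theorem initList_eq (M : FinTM2) (s : List (M.Γ M.k₀)) :
    initList M s = ⟨some M.main, M.initialState, single M.k₀ s⟩ := by
  unfold initList
  congr 1
  funext k
  by_cases h : k = M.k₀
  · subst h; simp
  · simp [h]

theorem haltList_eq (M : FinTM2) (s : List (M.Γ M.k₁)) :
    haltList M s = ⟨none, M.initialState, single M.k₁ s⟩ := by
  unfold haltList
  congr 1
  funext k
  by_cases h : k = M.k₁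
  · subst h; simp
  · simp [h]

theorem glue_single_fst (k : A.K) (s : List (A.Γ k)) :
    glue (B := B) (single k s) (fun _ => []) [] = single (Γ := Alph A B) (.inl k) s := by
  refine (update_glue_fst _ _ _ _ _).symm.trans ?_
  refine congrArg (fun S => Function.update S _ _) ?_
  funext j
  rcases j with j | j | j <;> rfl

theorem glue_single_snd (k : B.K) (s : List (B.Γ k)) :
    glue (A := A) (fun _ => []) (single k s) [] = single (Γ := Alph A B) (.inr (.inl k)) s := by
  refine (update_glue_snd _ _ _ _ _).symm.trans ?_
  refine congrArg (fun S => Function.update S _ _) ?_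
  funext j
  rcases j with j | j | j <;> rfl

variable (A B) in
/-- The composition of two machines. -/
def machine : FinTM2 where
  K := Stk A B
  kDecidableEq := inferInstance
  kFin := letI := A.kFin; letI := B.kFin; inferInstance
  k₀ := .inl A.k₀
  k₁ := .inr (.inl B.k₁)
  Γ := Alph A B
  Λ := Lbl A B
  main := .inl A.main
  ΛFin := letI := A.ΛFin; letI := B.ΛFin; inferInstance
  σ := State A B
  initialState := (A.initialState, B.initialState, none)
  σFin := letI := A.σFin; letI := B.σFin; inferInstance
  Γk₀Fin := A.Γk₀Fin
  m := code eA eB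

/-- The four phases are chained. They fit because a halting configuration has the initial state and
only the output stack filled, so the transfer leaves exactly an initial configuration of the second
machine. -/
theorem iterate_machine {s : List (A.Γ A.k₀)} {r : List (A.Γ A.k₁)} {w : List (B.Γ B.k₁)} {t t' : ℕ}
    (h : (flip bind A.step)^[t] (some (initList A s)) = some (haltList A r))
    (h' : (flip bind B.step)^[t'] (some (initList B (r.map fun x => eB (eA x)))) =
      some (haltList B w)) :
    (flip bind (machine A B eA eB).step)^[t + (r.length + 1) + (r.length + 1) + t']
      (some (initList (machine A B eA eB) s)) = some (haltList (machine A B eA eB) w) := by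
  rw [initList_eq, haltList_eq] at h h'
  have e₁ := iterate_fst eA eB t h B.initialState none (fun _ => []) []
  have e₂ := iterate_transfer_out eA eB r [] A.initialState B.initialState none
  have e₃ := iterate_transfer_in (A := A) eA eB (r.map eA).reverse [] A.initialState B.initialState
    none
  have e₄ := iterate_snd (A := A) eA eB t' h' A.initialState none (fun _ => []) []
  have e₅ : initList (machine A B eA eB) s = cfgFst B.initialState none (fun _ => []) []
      ⟨some A.main, A.initialState, single A.k₀ s⟩ :=
    (initList_eq (machine A B eA eB) s).trans
      (congrArg (fun S => (⟨_, _, S⟩ : TM2.Cfg (Alph A B) (Lbl A B) (State A B)))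
        (glue_single_fst A.k₀ s).symm)
  have e₆ : haltList (machine A B eA eB) w = cfgSnd A.initialState none (fun _ => []) []
      ⟨none, B.initialState, single B.k₁ w⟩ :=
    (haltList_eq (machine A B eA eB) w).trans
      (congrArg (fun S => (⟨_, _, S⟩ : TM2.Cfg (Alph A B) (Lbl A B) (State A B)))
        (glue_single_snd B.k₁ w).symm)
  rw [single_nil] at e₃
  rw [List.append_nil] at e₂ e₃
  rw [List.length_reverse, List.length_map, List.map_reverse, List.reverse_reverse,
    List.map_map] at e₃
  refine (congrArg (fun c => (flip bind (machine A B eA eB).step)^[_] (some c)) e₅).trans ?_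
  exact (iterate_bind_add (iterate_bind_add (iterate_bind_add e₁ e₂) e₃) e₄).trans
    (congrArg some e₆.symm)

end CompMachine

/-- Holds because the coefficients are natural numbers. -/
theorem eval_mono (p : Polynomial ℕ) {m n : ℕ} (h : m ≤ n) : p.eval m ≤ p.eval n := by
  induction p using Polynomial.induction_on' with
  | add p q hp hq => simpa using add_le_add hp hq
  | monomial k a => simpa using Nat.mul_le_mul_left a (Nat.pow_le_pow_left h k)

/-- The time is `p` for the first machine, `r + 1` for each of the two transfers, and `q` evaluated
at the bound `r` on the length of the intermediate string for the second machine. -/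
theorem computable_comp {α β γ : Type} {ea : α → List Bool} {eb : β → List Bool}
    {ec : γ → List Bool} {f : α → β} {g : β → γ}
    (hf : Nonempty (TM2ComputableInPolyTime ea eb f))
    (hg : Nonempty (TM2ComputableInPolyTime eb ec g)) :
    Nonempty (TM2ComputableInPolyTime ea ec (g ∘ f)) := by
  obtain ⟨⟨⟨A, iA, oA⟩, p, hA⟩⟩ := hf
  obtain ⟨⟨⟨B, iB, oB⟩, q, hB⟩⟩ := hg
  dsimp only at hA hB
  let _ := A.ΛFin
  let C : ℕ := Finset.univ.sup fun l => stmtSize (A.m l)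
  have hC : ∀ l, stmtSize (A.m l) ≤ C := fun l =>
    Finset.le_sup (f := fun l => stmtSize (A.m l)) (Finset.mem_univ l)
  -- The output stack holds at most the input at the start and grows by at most `C` in each of at
  -- most `p` steps.
  let r : Polynomial ℕ := Polynomial.X + Polynomial.C C * p
  have hlen : ∀ a, (eb (f a)).length ≤ r.eval (ea a).length := by
    intro a
    have h := length_stk_iterate_le hC A.k₁ _ (hA a).evals_in_steps
    have h₁ : ((initList A ((ea a).map iA.invFun)).stk A.k₁).length ≤ (ea a).length := by
      rw [CompMachine.initList_eq]
      simpa using CompMachine.length_single_le A.k₀ ((ea a).map iA.invFun) A.k₁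
    have h₂ : ((haltList A ((eb (f a)).map oA.invFun)).stk A.k₁).length = (eb (f a)).length := by
      rw [CompMachine.haltList_eq]
      simp
    have h₃ := Nat.mul_le_mul_left C (hA a).steps_le_m
    simp only [r, Polynomial.eval_add, Polynomial.eval_mul, Polynomial.eval_X, Polynomial.eval_C]
    omega
  refine ⟨⟨⟨CompMachine.machine A B oA iB.symm, iA, oB⟩, p + (r + 1) + (r + 1) + q.comp r,
    fun a => ⟨⟨_, CompMachine.iterate_machine oA iB.symm (hA a).evals_in_steps
      (t' := (hB (f a)).steps) (w := (ec (g (f a))).map oB.invFun) ?_⟩, ?_⟩⟩⟩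
  · have := (hB (f a)).evals_in_steps
    rw [List.map_map]
    refine Eq.trans (congrArg (fun l => (flip bind B.step)^[_] (some (initList B l))) ?_) this
    exact List.map_congr_left fun x _ => congrArg iB.symm (oA.apply_symm_apply x)
  · have h₁ := hlen a
    have h₂ := (hA a).steps_le_m
    have h₃ := (hB (f a)).steps_le_m
    have h₄ := eval_mono q h₁
    simp only [Polynomial.eval_add, Polynomial.eval_comp, Polynomial.eval_one, List.length_map]
    omega

/-! ### Program fragments -/

section Fragments

variable {Ks : List Prog} {S F : Store} {n : ℕ} {k a b : Reg}

theorem Store.get_set_self (S : Store) (k : Reg) (l : List Bool) : (S.set k l).get k = l := by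
  rw [get_set, Function.update_self]

theorem Store.get_set_of_ne (S : Store) (h : a ≠ b) (l : List Bool) :
    (S.set a l).get b = S.get b := by
  rw [get_set, Function.update_of_ne h.symm]

theorem Store.set_set_self (S : Store) (k : Reg) (l l' : List Bool) :
    (S.set k l).set k l' = S.set k l' := by
  cases k <;> rfl

theorem Store.set_comm (S : Store) (h : a ≠ b) (l l' : List Bool) :
    (S.set a l).set b l' = (S.set b l').set a l := by
  cases a <;> cases b <;> first | rfl | exact absurd rfl h

theorem Store.set_get_self (S : Store) (k : Reg) : S.set k (S.get k) = S := by
  cases k <;> rfl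

/-- The list of `k` ones. -/
abbrev ones (k : ℕ) : List Bool := List.replicate k true

theorem ones_append_cons (k : ℕ) (l : List Bool) : ones k ++ true :: l = true :: (ones k ++ l) := by
  induction k with
  | zero => rfl
  | succ k ih => simp only [ones, List.replicate_succ, List.cons_append] at ih ⊢; rw [ih]

/-- Empty a stack. -/
def drain (k : Reg) : Prog := .loop k Option.isSome fun _ => .nop

theorem exec_drain (h : Exec Ks (S.set k []) F n) :
    Exec (drain k :: Ks) S F (n + 2 * (S.get k).length + 2) := by
  generalize hl : S.get k = l
  induction l generalizing S with
  | nil =>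
    apply Exec.loop none (by rw [hl]; rfl)
    apply Exec.nop
    rw [hl]
    exact h
  | cons x l ih =>
    apply Exec.mono
    · apply Exec.loop (some x) (by rw [hl]; rfl)
      apply Exec.nop
      rw [hl]
      refine ih ?_ (Store.get_set_self _ _ _)
      rwa [Store.set_set_self]
    · simp only [List.length_cons]; omega

/-- Move the content of the stack `a` to the stack `b`, which reverses it. -/
def pour (a b : Reg) : Prog := .loop a Option.isSome fun o => o.elim .nop (.push b)

theorem exec_pour (hab : a ≠ b)
    (h : Exec Ks ((S.set b ((S.get a).reverse ++ S.get b)).set a []) F n) :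
    Exec (pour a b :: Ks) S F (n + 2 * (S.get a).length + 2) := by
  generalize hl : S.get a = l
  rw [hl] at h
  induction l generalizing S with
  | nil =>
    apply Exec.loop none (by rw [hl]; rfl)
    apply Exec.nop
    rw [hl]
    rwa [List.reverse_nil, List.nil_append, Store.set_get_self] at h
  | cons x l ih =>
    apply Exec.mono
    · apply Exec.loop (some x) (by rw [hl]; rfl)
      apply Exec.push
      rw [hl]
      apply ih
      · rw [Store.get_set_self, Store.get_set_of_ne _ hab, Store.set_set_self,
          Store.set_comm _ hab, Store.set_set_self]
        simpa using h
      · rw [Store.get_set_of_ne _ hab.symm, Store.get_set_self, List.tail_cons]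
    · simp only [List.length_cons]; omega

/-- Push the symbols of a list. -/
def pushAll (k : Reg) (l : List Bool) : Prog := l.foldr (fun b Q => .seq (.push k b) Q) .nop

theorem exec_pushAll {l : List Bool} (h : Exec Ks (S.set k (l.reverse ++ S.get k)) F n) :
    Exec (pushAll k l :: Ks) S F (n + l.length + 1) := by
  induction l generalizing S with
  | nil =>
    apply Exec.nop
    rwa [List.reverse_nil, List.nil_append, Store.set_get_self] at h
  | cons x l ih =>
    apply Exec.mono
    · apply Exec.seq
      apply Exec.push
      apply ih
      rw [Store.set_set_self, Store.get_set_self]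
      simpa using h
    · simp only [List.length_cons]; omega

/-- For each symbol in the stack `a`, push a one on the stacks `b` and `d`; empty the stack `a`. -/
def split (a b d : Reg) : Prog :=
  .loop a Option.isSome fun o => o.elim .nop fun _ => .seq (.push b true) (.push d true)

/-- Followed by pouring `d` back into `a`, this adds a unary number to `b` without losing it;
reversal is harmless as all symbols are ones. -/
theorem exec_split {d : Reg} (hab : a ≠ b) (had : a ≠ d) (hbd : b ≠ d)
    (h : Exec Ks (((S.set b (ones (S.get a).length ++ S.get b)).set d
      (ones (S.get a).length ++ S.get d)).set a []) F n) :
    Exec (split a b d :: Ks) S F (n + 3 * (S.get a).length + 2) := by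
  generalize hl : S.get a = l
  rw [hl] at h
  induction l generalizing S with
  | nil =>
    apply Exec.loop none (by rw [hl]; rfl)
    apply Exec.nop
    rw [hl]
    have h' : Exec Ks (S.set a []) F n := by
      simpa only [ones, List.length_nil, List.replicate_zero, List.nil_append,
        Store.set_get_self] using h
    exact h'
  | cons x l ih =>
    apply Exec.mono
    · apply Exec.loop (some x) (by rw [hl]; rfl)
      apply Exec.seq
      apply Exec.push
      apply Exec.push
      rw [hl]
      apply ih
      · simp only [ones, List.length_cons, List.replicate_succ', List.append_assoc,
          List.singleton_append] at h
        rw [Store.get_set_self, Store.get_set_of_ne _ hab, Store.get_set_of_ne _ hbd.symm,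
          Store.get_set_self, Store.get_set_of_ne _ hbd, Store.get_set_of_ne _ had,
          Store.set_comm _ hbd.symm, Store.set_set_self, Store.set_set_self,
          Store.set_comm _ hab, Store.set_comm _ had, Store.set_set_self]
        exact h
      · rw [Store.get_set_of_ne _ had.symm, Store.get_set_of_ne _ hab.symm, Store.get_set_self,
          List.tail_cons]
    · simp only [List.length_cons]; omega

end Fragments

/-! ### Copying numbers and substituting for variables in prefix notation -/

section Copying

variable {Ks : List Prog} {F : Store} {n : ℕ} {inp out sav idx len rem tmp aux : List Bool}

/-- Move a number in unary from the input to the output, keeping a copy of it. -/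
def copyUnary : Prog :=
  .loop .inp (fun o => o.getD false) fun o =>
    .seq (.push .sav (o.getD false)) (.push .out (o.getD false))

theorem exec_copyUnary (k : ℕ)
    (h : Exec Ks ⟨inp, (unary k).reverse ++ out, (unary k).reverse ++ sav, idx, len, rem, tmp, aux⟩
      F n) :
    Exec (copyUnary :: Ks) ⟨unary k ++ inp, out, sav, idx, len, rem, tmp, aux⟩ F
      (n + 3 * k + 3) := by
  induction k generalizing out sav with
  | zero =>
    apply Exec.loop (some false) rfl
    apply Exec.seq
    apply Exec.push
    apply Exec.push
    exact h
  | succ k ih =>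
    apply Exec.mono
    · apply Exec.loop (some true) rfl
      apply Exec.seq
      apply Exec.push
      apply Exec.push
      apply ih
      simpa [unary, List.replicate_succ, ones_append_cons, Store.get, Store.set] using h
    · omega

/-- Read expressions, replacing the variables as the program `V` does, and keep a copy. -/
def tokens (V : Prog) : Prog :=
  .loop .inp Option.isSome fun o => o.elim .nop fun b₁ =>
    .seq (.push .sav b₁) <| .loop .inp (fun _ => false) fun o => o.elim .nop fun b₂ =>
      .seq (.push .sav b₂) <| cond (b₁ || b₂) (.seq (.push .out b₁) (.push .out b₂)) V

/-- The bits of an expression in which the variables have been replaced. -/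
def BExpr.bitsWith {V : Type} (w : V → List Bool) : BExpr V → List Bool
  | .var v => w v
  | .not e => false :: true :: e.bitsWith w
  | .and e₁ e₂ => true :: false :: (e₁.bitsWith w ++ e₂.bitsWith w)
  | .or e₁ e₂ => true :: true :: (e₁.bitsWith w ++ e₂.bitsWith w)

theorem exec_tokens_nil {V : Prog}
    (h : Exec Ks ⟨[], out, sav, idx, len, rem, tmp, aux⟩ F n) :
    Exec (tokens V :: Ks) ⟨[], out, sav, idx, len, rem, tmp, aux⟩ F (n + 2) := by
  apply Exec.loop none rfl
  apply Exec.nop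
  exact h

theorem exec_tokens_operator {V : Prog} {b₁ b₂ : Bool} (hb : (b₁ || b₂) = true)
    (h : Exec (tokens V :: Ks)
      ⟨inp, b₂ :: b₁ :: out, b₂ :: b₁ :: sav, idx, len, rem, tmp, aux⟩ F n) :
    Exec (tokens V :: Ks) ⟨b₁ :: b₂ :: inp, out, sav, idx, len, rem, tmp, aux⟩ F (n + 6) := by
  apply Exec.loop (some b₁) rfl
  apply Exec.seq
  apply Exec.push
  apply Exec.loop (some b₂) rfl
  apply Exec.seq
  apply Exec.push
  rw [hb]
  apply Exec.seq
  apply Exec.push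
  apply Exec.push
  exact h

/-- The program is a flat loop over tokens, while the induction is on the expression with arbitrary
remaining input: prefix notation lets the loop proceed from one subexpression to the next without a
stack of pending operators. `C` bounds the cost of any variable. -/
theorem exec_tokens_bits {V : Prog} {X : Type} {num : X → ℕ} {w : X → List Bool} {C : ℕ}
    (hV : ∀ {Ks inp out sav F n} (v : X),
      Exec Ks ⟨inp, (w v).reverse ++ out, (unary (num v)).reverse ++ sav, idx, len, rem, tmp, aux⟩
        F n →
      Exec (V :: Ks) ⟨unary (num v) ++ inp, out, sav, idx, len, rem, tmp, aux⟩ F (n + C))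
    (e : BExpr X)
    (h : Exec (tokens V :: Ks) ⟨inp, (e.bitsWith w).reverse ++ out, (e.bits num).reverse ++ sav,
      idx, len, rem, tmp, aux⟩ F n) :
    Exec (tokens V :: Ks) ⟨e.bits num ++ inp, out, sav, idx, len, rem, tmp, aux⟩ F
      (n + (C + 6) * (e.bits num).length) := by
  induction e generalizing inp out sav n with
  | var v =>
    apply Exec.mono
    · apply Exec.loop (some false) rfl
      apply Exec.seq
      apply Exec.push
      apply Exec.loop (some false) rfl
      apply Exec.seq
      apply Exec.push
      apply hV v
      have h' : Exec (tokens V :: Ks) ⟨inp, (w v).reverse ++ out,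
          (unary (num v)).reverse ++ (false :: false :: sav), idx, len, rem, tmp, aux⟩ F n := by
        simpa [BExpr.bits, BExpr.bitsWith] using h
      exact h'
    · simp only [BExpr.bits, List.length_cons]
      nlinarith
  | not e ih =>
    apply Exec.mono
    · apply exec_tokens_operator (b₁ := false) (b₂ := true) rfl
      apply ih
      simpa [BExpr.bits, BExpr.bitsWith] using h
    · simp only [BExpr.bits, List.length_cons]
      nlinarith
  | and e₁ e₂ ih₁ ih₂ =>
    apply Exec.mono
    · rw [show (BExpr.and e₁ e₂).bits num ++ inp =
        true :: false :: (e₁.bits num ++ (e₂.bits num ++ inp)) by simp [BExpr.bits]]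
      apply exec_tokens_operator rfl
      apply ih₁
      apply ih₂
      simpa [BExpr.bits, BExpr.bitsWith] using h
    · simp only [BExpr.bits, List.length_cons, List.length_append]
      nlinarith
  | or e₁ e₂ ih₁ ih₂ =>
    apply Exec.mono
    · rw [show (BExpr.or e₁ e₂).bits num ++ inp =
        true :: true :: (e₁.bits num ++ (e₂.bits num ++ inp)) by simp [BExpr.bits]]
      apply exec_tokens_operator rfl
      apply ih₁
      apply ih₂
      simpa [BExpr.bits, BExpr.bitsWith] using h
    · simp only [BExpr.bits, List.length_cons, List.length_append]
      nlinarith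

theorem exec_tokens {V : Prog} {X : Type} {num : X → ℕ} {w : X → List Bool} {C : ℕ}
    (hV : ∀ {Ks inp out sav F n} (v : X),
      Exec Ks ⟨inp, (w v).reverse ++ out, (unary (num v)).reverse ++ sav, idx, len, rem, tmp, aux⟩
        F n →
      Exec (V :: Ks) ⟨unary (num v) ++ inp, out, sav, idx, len, rem, tmp, aux⟩ F (n + C))
    (e : BExpr X)
    (h : Exec Ks ⟨[], (e.bitsWith w).reverse ++ out, (e.bits num).reverse ++ sav,
      idx, len, rem, tmp, aux⟩ F n) :
    Exec (tokens V :: Ks) ⟨e.bits num, out, sav, idx, len, rem, tmp, aux⟩ F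
      (n + 2 + (C + 6) * (e.bits num).length) := by
  have := exec_tokens_bits hV e (exec_tokens_nil h)
  rwa [List.append_nil] at this

/-- The substitution of expressions for the variables. -/
def BExpr.bind {V W : Type} (σ : V → BExpr W) : BExpr V → BExpr W
  | .var v => σ v
  | .not e => .not (e.bind σ)
  | .and e₁ e₂ => .and (e₁.bind σ) (e₂.bind σ)
  | .or e₁ e₂ => .or (e₁.bind σ) (e₂.bind σ)

theorem BExpr.eval_bind {V W : Type} (σ : V → BExpr W) (e : BExpr V) (a : W → Bool) :
    (e.bind σ).eval a = e.eval fun v => (σ v).eval a := by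
  induction e <;> simp_all [bind, eval]

/-- In prefix notation without parentheses the code of a substituted expression arises by replacing
the variable tokens in place, which is what `tokens` does. -/
theorem BExpr.bits_bind {V W : Type} (σ : V → BExpr W) (num : W → ℕ) (e : BExpr V) :
    (e.bind σ).bits num = e.bitsWith fun v => (σ v).bits num := by
  induction e <;> simp_all [bind, bits, bitsWith]

theorem BExpr.bitsWith_unary {V : Type} (num : V → ℕ) (e : BExpr V) :
    (e.bitsWith fun v => false :: false :: unary (num v)) = e.bits num := by
  induction e <;> simp_all [bits, bitsWith]

theorem length_unary (k : ℕ) : (unary k).length = k + 1 := by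
  simp [unary]

theorem one_le_length_bits {V : Type} (num : V → ℕ) (e : BExpr V) : 1 ≤ (e.bits num).length := by
  cases e <;> simp [BExpr.bits]

end Copying

section Simple

variable {Ks : List Prog} {F : Store} {n : ℕ} {inp out sav idx len rem tmp aux : List Bool}

theorem unary_zero : unary 0 = [false] := rfl

theorem unary_succ (k : ℕ) : unary (k + 1) = true :: unary k := rfl

theorem reverse_unary (k : ℕ) : (unary k).reverse = false :: ones k := by
  simp [unary]

/-! ### Negation of the first variable -/

/-- The literal that replaces a variable when the first variable is negated. -/
def flipVar (m m' : ℕ) : Fin m ⊕ Fin m' → BExpr (Fin m ⊕ Fin m')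
  | .inl i => if (i : ℕ) = 0 then .not (.var (.inl i)) else .var (.inl i)
  | .inr j => .var (.inr j)

/-- The instance in which the first variable is negated. -/
def Inst₂.flip (I : Inst₂) : Inst₂ := ⟨I.m, I.m', I.pos, I.f.bind (flipVar I.m I.m')⟩

/-- The program sees only the number of a variable. As `0 < m`, the number 0 belongs to the first
bit of `x` and never to a bit of `y`. -/
theorem bits_flipVar {m m' : ℕ} (hm : 0 < m) (v : Fin m ⊕ Fin m') :
    (flipVar m m' v).bits (num₂ m m') =
      if num₂ m m' v = 0 then [false, true, false, false, false]
      else false :: false :: unary (num₂ m m' v) := by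
  rcases v with ⟨i, hi⟩ | ⟨j, hj⟩
  · by_cases h : i = 0 <;> simp [flipVar, num₂, h, BExpr.bits, unary]
  · simp [flipVar, num₂, BExpr.bits, hm.ne']

/-- Read a variable; negate the first one. -/
def flipVarProg : Prog :=
  .loop .inp (fun _ => false) fun o => cond (o.getD false)
    (.seq (.push .sav true) (.seq (pushAll .out [false, false, true]) copyUnary))
    (.seq (.push .sav false) (pushAll .out [false, true, false, false, false]))

theorem exec_flipVarProg (k : ℕ)
    (h : Exec Ks ⟨inp, (if k = 0 then [false, true, false, false, false]
        else false :: false :: unary k).reverse ++ out, (unary k).reverse ++ sav, idx, len, rem, tmp,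
        aux⟩ F n) :
    Exec (flipVarProg :: Ks) ⟨unary k ++ inp, out, sav, idx, len, rem, tmp, aux⟩ F
      (n + (3 * k + 10)) := by
  cases k with
  | zero =>
    apply Exec.mono
    · apply Exec.loop (some false) rfl
      apply Exec.seq
      apply Exec.push
      apply exec_pushAll
      exact h
    · simp
  | succ k =>
    apply Exec.mono
    · apply Exec.loop (some true) rfl
      apply Exec.seq
      apply Exec.push
      apply Exec.seq
      apply exec_pushAll
      apply exec_copyUnary k
      have h' : Exec Ks ⟨inp, (unary k).reverse ++ ([false, false, true].reverse ++ out),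
          (unary k).reverse ++ (true :: sav), idx, len, rem, tmp, aux⟩ F n := by
        simpa [unary_succ] using h
      exact h'
    · simp only [List.length_cons, List.length_nil]; omega

/-- Negate the first variable of an instance. -/
def flipProg : Prog :=
  .seq copyUnary <| .seq copyUnary <| .seq (tokens flipVarProg) <| .seq (drain .sav) (pour .out .inp)

/-- The number `num v + 3` is the length of the code of the variable `v`: two tag bits, the ones and
the final zero. -/
theorem length_bitsWith_le {V : Type} {w : V → List Bool} {num : V → ℕ} {c : ℕ} (hc : 1 ≤ c)
    (hw : ∀ v, (w v).length ≤ c * (num v + 3)) (e : BExpr V) :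
    (e.bitsWith w).length ≤ c * (e.bits num).length := by
  induction e with
  | var v => simpa [BExpr.bits, BExpr.bitsWith, length_unary] using hw v
  | not e ih => simp only [BExpr.bits, BExpr.bitsWith, List.length_cons]; nlinarith
  | and e₁ e₂ ih₁ ih₂ =>
    simp only [BExpr.bits, BExpr.bitsWith, List.length_cons, List.length_append]; nlinarith
  | or e₁ e₂ ih₁ ih₂ =>
    simp only [BExpr.bits, BExpr.bitsWith, List.length_cons, List.length_append]; nlinarith

theorem length_code₂ (I : Inst₂) :
    I.code.1.length = I.m + 1 + (I.m' + 1 + (I.f.bits (num₂ I.m I.m')).length) := by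
  simp [Inst₂.code, length_unary]

theorem computable_flip : Nonempty (TM2ComputableInPolyTime (fun I : Inst₂ => I.code.1)
    (fun I : Inst₂ => I.code.1) Inst₂.flip) := by
  -- Quadratic: the cost per bit of the expression is linear in `m + m'`.
  refine computable_of_run flipProg (40 + 40 * Polynomial.X + 3 * Polynomial.X ^ 2) fun I => ?_
  obtain ⟨m, m', hm, f⟩ := I
  have hV : ∀ {Ks : List Prog} {inp out sav : List Bool} {F : Store} {n : ℕ} (v : Fin m ⊕ Fin m'),
      Exec Ks ⟨inp, ((flipVar m m' v).bits (num₂ m m')).reverse ++ out,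
        (unary (num₂ m m' v)).reverse ++ sav, [], [], [], [], []⟩ F n →
      Exec (flipVarProg :: Ks) ⟨unary (num₂ m m' v) ++ inp, out, sav, [], [], [], [], []⟩ F
        (n + (3 * (m + m') + 10)) := by
    intro Ks inp out sav F n v h
    rw [bits_flipVar hm] at h
    refine (exec_flipVarProg _ h).mono ?_
    have : num₂ m m' v < m + m' := by
      rcases v with ⟨i, hi⟩ | ⟨j, hj⟩ <;> simp [num₂] <;> omega
    omega
  have hlen := length_bitsWith_le (w := fun v => (flipVar m m' v).bits (num₂ m m')) (c := 2)
    (num := num₂ m m') (by norm_num) (fun v => by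
      rw [bits_flipVar hm]
      split_ifs with h0 <;> simp [length_unary, h0]) f
  apply Exec.run
  apply Exec.mono
  · rw [Inst₂.code]
    apply Exec.seq
    apply exec_copyUnary m
    apply Exec.seq
    apply exec_copyUnary m'
    apply Exec.seq
    apply exec_tokens hV f
    apply Exec.seq
    apply exec_drain
    apply exec_pour (by decide)
    apply Exec.nil
    simp [Store.get, Store.set, Store.ofInp, Inst₂.code, Inst₂.flip, BExpr.bits_bind]
  · rw [length_code₂]
    simp [Store.get, Store.set, length_unary]
    nlinarith

/-! ### Making a satisfiable instance out of an instance -/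

/-- The instance `¬ b ∨ f(x)` with the variables `(b, x)`. -/
def Inst₁.guard (I : Inst₁) : Inst₁ :=
  ⟨I.m + 1, Nat.succ_pos _, .or (.not (.var 0)) (I.f.bind fun i => .var i.succ)⟩

/-- Read a variable; increase its number. -/
def succVarProg : Prog := .seq (pushAll .out [false, false, true]) copyUnary

theorem exec_succVarProg (k : ℕ)
    (h : Exec Ks ⟨inp, (false :: false :: unary (k + 1)).reverse ++ out, (unary k).reverse ++ sav,
      idx, len, rem, tmp, aux⟩ F n) :
    Exec (succVarProg :: Ks) ⟨unary k ++ inp, out, sav, idx, len, rem, tmp, aux⟩ F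
      (n + (3 * k + 7)) := by
  apply Exec.mono
  · apply Exec.seq
    apply exec_pushAll
    apply exec_copyUnary k
    have h' : Exec Ks ⟨inp, (unary k).reverse ++ ([false, false, true].reverse ++ out),
        (unary k).reverse ++ sav, idx, len, rem, tmp, aux⟩ F n := by
      simpa [unary_succ] using h
    exact h'
  · simp only [List.length_cons, List.length_nil]; omega

/-- Make a satisfiable instance. -/
def guardProg : Prog :=
  .seq (.push .out true) <| .seq copyUnary <|
  -- The one pushed before makes `m` into `m + 1`; these bits are the tags of `or` and `not` and the
  -- variable 0.
  .seq (pushAll .out [true, true, false, true, false, false, false]) <|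
  .seq (tokens succVarProg) <| .seq (drain .sav) (pour .out .inp)

theorem length_code₁ (I : Inst₁) :
    I.code.1.length = I.m + 1 + (I.f.bits Fin.val).length := by
  simp [Inst₁.code, length_unary]

theorem computable_guard : Nonempty (TM2ComputableInPolyTime (fun I : Inst₁ => I.code.1)
    (fun I : Inst₁ => I.code.1) Inst₁.guard) := by
  refine computable_of_run guardProg (60 + 60 * Polynomial.X + 3 * Polynomial.X ^ 2) fun I => ?_
  obtain ⟨m, hm, f⟩ := I
  have hV : ∀ {Ks : List Prog} {inp out sav : List Bool} {F : Store} {n : ℕ} (v : Fin m),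
      Exec Ks ⟨inp, (false :: false :: unary (v + 1)).reverse ++ out,
        (unary v).reverse ++ sav, [], [], [], [], []⟩ F n →
      Exec (succVarProg :: Ks) ⟨unary v ++ inp, out, sav, [], [], [], [], []⟩ F
        (n + (3 * m + 7)) :=
    fun v h => (exec_succVarProg _ h).mono (by omega)
  have hlen := length_bitsWith_le (w := fun v : Fin m => false :: false :: unary (v + 1)) (c := 2)
    (num := Fin.val) (by norm_num) (fun v => by
      simp [length_unary]) f
  apply Exec.run
  apply Exec.mono
  · rw [Inst₁.code]
    apply Exec.seq
    apply Exec.push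
    apply Exec.seq
    apply exec_copyUnary m
    apply Exec.seq
    apply exec_pushAll
    apply Exec.seq
    apply exec_tokens hV f
    apply Exec.seq
    apply exec_drain
    apply exec_pour (by decide)
    apply Exec.nil
    simp [Store.get, Store.set, Store.ofInp, Inst₁.code, Inst₁.guard, BExpr.bits_bind, BExpr.bits,
      unary_succ, unary_zero]
  · rw [length_code₁]
    simp [Store.get, Store.set, Store.ofInp, length_unary]
    nlinarith

end Simple

/-! ### The formula for the greatest solution -/

/-- The number of the pairs `(k, j)` with `k < i` and `k < j < m`. -/
def pairBase (m i : ℕ) : ℕ := ∑ k ∈ Finset.range i, (m - 1 - k)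

theorem pairBase_zero (m : ℕ) : pairBase m 0 = 0 := rfl

theorem pairBase_succ (m i : ℕ) : pairBase m (i + 1) = pairBase m i + (m - 1 - i) :=
  Finset.sum_range_succ _ _

theorem pairBase_self (m : ℕ) : pairBase m m = m * (m - 1) / 2 := by
  rw [pairBase, Finset.sum_range_reflect (fun k => k), Finset.sum_range_id]

theorem pairBase_le (m i : ℕ) : pairBase m i ≤ i * m := by
  induction i with
  | zero => simp [pairBase_zero]
  | succ i ih => rw [pairBase_succ, Nat.succ_mul]; omega

/-- The pairs `i < j` in terms of `i` and `j - i - 1`. -/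
def pairsEquivSigma (m : ℕ) : Pairs m ≃ Σ i : Fin m, Fin (m - 1 - i) where
  toFun p := ⟨p.1.1, ⟨p.1.2 - p.1.1 - 1, by have := p.2; have := p.1.2.2; omega⟩⟩
  invFun q := ⟨(q.1, ⟨q.1 + q.2 + 1, by omega⟩), by
    show (q.1 : ℕ) < q.1 + q.2 + 1; omega⟩
  left_inv p := by
    obtain ⟨⟨i, j⟩, h⟩ := p
    have h' : (i : ℕ) < j := h
    simp only [Subtype.mk.injEq, Prod.mk.injEq, true_and]
    ext
    simp only
    omega
  right_inv q := by
    obtain ⟨i, d⟩ := q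
    simp only [Sigma.mk.injEq, heq_eq_eq, true_and]
    ext
    simp only
    omega

/-- The lexicographic numbering of the pairs `i < j`. -/
def pairIndex (m : ℕ) : Pairs m ≃ Fin (m * (m - 1) / 2) :=
  (pairsEquivSigma m).trans <| finSigmaFinEquiv.trans <| finCongr <| by
    rw [← pairBase_self, pairBase, Finset.sum_range]

/-- Row `i` starts at `pairBase m i`, and its first entry is the pair `(i, i + 1)`, whence the
subtraction of 1. -/
theorem pairIndex_val {m : ℕ} (p : Pairs m) :
    (pairIndex m p : ℕ) = pairBase m p.1.1 + (p.1.2 - p.1.1 - 1) := by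
  simp only [pairIndex, Equiv.trans_apply, finCongr_apply, Fin.val_cast, finSigmaFinEquiv_apply]
  simp [pairsEquivSigma, pairBase, Finset.sum_range]
  rfl

/-- The expression that replaces the variable `v` in the `i`-th conjunct. Since it stands in
`x_i ∨ ¬ f(…)`, the variable `x_i` may be replaced by `¬ x_i` instead of `1`. -/
def splicedVar {m : ℕ} (i v : Fin m) : BExpr (Fin m ⊕ Fin (m * (m - 1) / 2)) :=
  if h : i < v then .var (.inr (pairIndex m ⟨(i, v), h⟩))
  else if v = i then .not (.var (.inl i)) else .var (.inl v)

/-- The conjunct `x_i ∨ ¬ f(x_1, …, x_{i-1}, 1, y_{i,i+1}, …, y_{i,m})`. -/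
def conjunct {m : ℕ} (f : BExpr (Fin m)) (i : Fin m) : BExpr (Fin m ⊕ Fin (m * (m - 1) / 2)) :=
  .or (.var (.inl i)) (.not (f.bind (splicedVar i)))

/-- The conjunction of `f(x)` and the conjuncts for the indices in a list. -/
def conjunction {m : ℕ} (f : BExpr (Fin m)) (l : List (Fin m)) :
    BExpr (Fin m ⊕ Fin (m * (m - 1) / 2)) :=
  l.foldr (fun i g => .and (conjunct f i) g) (f.bind fun i => .var (.inl i))

/-- The instance for the greatest solution. -/
def Inst₁.greatest (I : Inst₁) : Inst₂ :=
  ⟨I.m, I.m * (I.m - 1) / 2, I.pos, conjunction I.f (List.finRange I.m)⟩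

theorem eval_conjunction {m : ℕ} (f : BExpr (Fin m)) (l : List (Fin m))
    (a : Fin m ⊕ Fin (m * (m - 1) / 2) → Bool) :
    (conjunction f l).eval a = true ↔
      f.eval (fun i => a (.inl i)) = true ∧ ∀ i ∈ l, (conjunct f i).eval a = true := by
  induction l with
  | nil => simp [conjunction, BExpr.eval_bind, BExpr.eval]
  | cons i l ih =>
    have : (conjunction f (i :: l)).eval a = ((conjunct f i).eval a && (conjunction f l).eval a) :=
      rfl
    rw [this, Bool.and_eq_true, ih, List.forall_mem_cons]
    tauto

/-- If `x_i = 1`, then both sides are true; if `x_i = 0`, then the literal `¬ x_i` has the value 1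
that `spliced` puts there. This avoids constants, which the expressions do not have. -/
theorem eval_conjunct {m : ℕ} (f : BExpr (Fin m)) (i : Fin m) (x : Fin m → Bool)
    (y : Fin (m * (m - 1) / 2) → Bool) :
    (conjunct f i).eval (Sum.elim x y) = (x i || !(f.eval (spliced x (y ∘ pairIndex m) i))) := by
  simp only [conjunct, BExpr.eval, BExpr.eval_bind, Sum.elim_inl]
  cases hx : x i with
  | true => rfl
  | false =>
    have : (fun v => (splicedVar i v).eval (Sum.elim x y)) = spliced x (y ∘ pairIndex m) i := by
      funext v
      unfold splicedVar spliced
      split_ifs with h₁ h₂ <;> simp [BExpr.eval, hx]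
    rw [this]

theorem eval_greatest {m : ℕ} (f : BExpr (Fin m)) (x : Fin m → Bool)
    (y : Fin (m * (m - 1) / 2) → Bool) :
    (conjunction f (List.finRange m)).eval (Sum.elim x y) =
      maxFormula f.eval x (y ∘ pairIndex m) := by
  rw [Bool.eq_iff_iff, eval_conjunction]
  simp only [eval_conjunct, maxFormula, Bool.and_eq_true, decide_eq_true_eq, Sum.elim_inl,
    List.mem_finRange, true_imp_iff]

/-- A solution above `x` and a failing conjunct are the same thing: the first difference gives the
index `i`, and the bits behind it give the values of `y_{i,j}`. -/
theorem forall_maxFormula_iff {m : ℕ} (f : (Fin m → Bool) → Bool) (x : Fin m → Bool) :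
    (∀ y, maxFormula f x y = true) ↔ IsMaxSat f x := by
  simp only [maxFormula, Bool.and_eq_true, decide_eq_true_eq, IsMaxSat, IsGreatest, upperBounds,
    Set.mem_ofPred_eq, ofLex_toLex]
  constructor
  · intro h
    refine ⟨(h fun _ => true).1, fun z hz => ?_⟩
    by_contra hlt
    obtain ⟨i, hi, hi'⟩ := not_le.1 hlt
    have hxi : x i = false ∧ ofLex z i = true := by
      have : x i < ofLex z i := hi'
      revert this
      cases x i <;> cases ofLex z i <;> decide
    -- With `y_{i,j} = z_j` the spliced string is `z` itself, so the `i`-th conjunct fails.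
    have := (h fun p => ofLex z p.1.2).2 i
    have hs : spliced x (fun p => ofLex z p.1.2) i = ofLex z := by
      funext j
      unfold spliced
      split_ifs with h₁ h₂
      · rfl
      · rw [h₂, hxi.2]
      · exact hi j (lt_of_le_of_ne (not_lt.1 h₁) h₂)
    rw [hs, hxi.1, hz] at this
    simp at this
  · rintro ⟨hx, hmax⟩ y
    refine ⟨hx, fun i => ?_⟩
    by_contra hi
    have hi₁ : x i = false := by
      cases h : x i
      · rfl
      · simp [h] at hi
    have hi₂ : f (spliced x y i) = true := by
      cases h : f (spliced x y i)
      · simp [h] at hi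
      · rfl
    -- Conversely, a failing conjunct exhibits a solution that agrees with `x` before `i` and
    -- exceeds it at `i`.
    have hle := hmax (a := toLex (spliced x y i)) hi₂
    refine absurd hle (not_le.2 ⟨i, fun j hj => ?_, ?_⟩)
    · show x j = spliced x y i j
      simp [spliced, hj.not_gt, hj.ne]
    · show x i < spliced x y i i
      simp [spliced, hi₁]

theorem forall_greatest_iff {m : ℕ} (f : BExpr (Fin m)) (x : Fin m → Bool) :
    (∀ y : Fin (m * (m - 1) / 2) → Bool,
      (conjunction f (List.finRange m)).eval (Sum.elim x y) = true) ↔ IsMaxSat f.eval x := by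
  simp only [eval_greatest]
  rw [← forall_maxFormula_iff]
  refine ⟨fun h y => ?_, fun h y => h _⟩
  have := h (y ∘ (pairIndex m).symm)
  rwa [Function.comp_assoc, Equiv.symm_comp_self, Function.comp_id] at this

/-! ### The program for the greatest solution -/

section Greatest

variable {Ks : List Prog} {F : Store} {n : ℕ} {inp out sav idx len rem tmp aux : List Bool}

/-- Read the number of a variable and subtract it from the number in the stack `idx`. The stacks
`tmp` and `aux` receive what has been subtracted, and what could not be subtracted. If the number is
not terminated, then the stack `aux` receives an additional symbol. -/
def compareProg : Prog :=
  .loop .inp (fun o => o.getD false) fun o => o.elim (.push .aux true) fun b => cond b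
    (.seq (.push .sav true) <| .loop .idx (fun _ => false) fun o =>
      cond o.isSome (.push .tmp true) (.push .aux true))
    (.push .sav false)

/-- Truncated subtraction in both directions is a three-way comparison: for `a = 0`, the stack `aux`
is nonempty iff `i < j`, and `idx` is nonempty iff `j < i`. The stack `tmp` keeps what is needed to
restore `idx`. -/
theorem exec_compareProg (j i t a : ℕ)
    (h : Exec Ks ⟨inp, out, (unary j).reverse ++ sav, ones (i - j), len, rem, ones (min i j + t),
      ones (j - i + a)⟩ F n) :
    Exec (compareProg :: Ks) ⟨unary j ++ inp, out, sav, ones i, len, rem, ones t, ones a⟩ F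
      (n + 4 * j + 2) := by
  induction j generalizing i t a sav with
  | zero =>
    apply Exec.loop (some false) rfl
    apply Exec.push
    simpa [reverse_unary, unary_zero, Store.get, Store.set] using h
  | succ j ih =>
    apply Exec.mono
    · apply Exec.loop (some true) rfl
      apply Exec.seq
      apply Exec.push
      cases i with
      | zero =>
        apply Exec.loop none rfl
        apply Exec.push
        apply ih 0 t (a + 1)
        simpa [reverse_unary, unary_succ, List.replicate_succ, ones_append_cons, add_assoc,
          add_comm a 1, Store.get, Store.set] using h
      | succ i =>
        apply Exec.loop (some true) rfl
        apply Exec.push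
        apply ih i (t + 1) a
        simpa [reverse_unary, unary_succ, List.replicate_succ, ones_append_cons, add_assoc,
          add_comm t 1, Store.get, Store.set] using h
    · omega

/-- Read a variable and write the expression that replaces it in the conjunct whose index is in the
stack `idx`. -/
def splicedVarProg : Prog :=
  .seq compareProg <| .loop .aux (fun _ => false) fun o => cond o.isSome
    (.seq (pushAll .out [false, false]) <| .seq (pour .tmp .idx) <| .seq (split .len .out .tmp) <|
      .seq (pour .tmp .len) <| .seq (pour .aux .out) (.push .out false))
    (.loop .idx (fun _ => false) fun o => cond o.isSome
      (.seq (.push .idx true) <| .seq (pushAll .out [false, false]) <|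
        .seq (split .tmp .out .idx) (.push .out false))
      (.seq (pushAll .out [false, true, false, false]) <|
        .seq (split .tmp .out .idx) (.push .out false)))

theorem ones_append_ones (k l : ℕ) : ones k ++ ones l = ones (k + l) :=
  List.replicate_append_replicate

theorem exec_splicedVarProg (i j L : ℕ)
    (h : Exec Ks ⟨inp, (if i < j then false :: false :: unary (L + (j - i - 1))
        else if j = i then false :: true :: false :: false :: unary i
        else false :: false :: unary j).reverse ++ out,
      (unary j).reverse ++ sav, ones i, ones L, rem, [], []⟩ F n) :
    Exec (splicedVarProg :: Ks) ⟨unary j ++ inp, out, sav, ones i, ones L, rem, [], []⟩ F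
      (n + (6 * j + 5 * L + 2 * i + 20)) := by
  rcases lt_trichotomy i j with hij | hij | hij
  · obtain ⟨d, rfl⟩ : ∃ d, j = i + 1 + d := ⟨j - (i + 1), by omega⟩
    rw [if_pos hij, show i + 1 + d - i - 1 = d by omega] at h
    apply Exec.mono
    · apply Exec.seq
      apply exec_compareProg (i + 1 + d) i 0 0
      rw [show i - (i + 1 + d) = 0 by omega, show min i (i + 1 + d) + 0 = i by omega,
        show i + 1 + d - i + 0 = d + 1 by omega]
      -- The test itself removes one of the `j - i` ones, leaving the offset `j - i - 1` within row
      -- `i`.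
      apply Exec.loop (some true) rfl
      apply Exec.seq
      apply exec_pushAll
      apply Exec.seq
      apply exec_pour (by decide)
      apply Exec.seq
      apply exec_split (by decide) (by decide) (by decide)
      apply Exec.seq
      apply exec_pour (by decide)
      apply Exec.seq
      apply exec_pour (by decide)
      apply Exec.push
      have h' : Exec Ks ⟨inp, false :: (ones d ++ (ones L ++ false :: false :: out)),
          (unary (i + 1 + d)).reverse ++ sav, ones i, ones L, rem, [], []⟩ F n := by
        rw [← List.append_assoc, ones_append_ones, add_comm d L]
        simpa [reverse_unary] using h
      simpa [Store.get, Store.set, reverse_unary, List.replicate_succ] using h'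
    · simp [Store.get, Store.set]; omega
  · subst hij
    rw [if_neg (lt_irrefl _), if_pos rfl] at h
    apply Exec.mono
    · apply Exec.seq
      apply exec_compareProg i i 0 0
      rw [show i - i = 0 by omega, show min i i + 0 = i by omega]
      apply Exec.loop none rfl
      apply Exec.loop none rfl
      apply Exec.seq
      apply exec_pushAll
      apply Exec.seq
      apply exec_split (by decide) (by decide) (by decide)
      apply Exec.push
      simpa [Store.get, Store.set, reverse_unary] using h
    · simp [Store.get, Store.set]; omega
  · obtain ⟨d, rfl⟩ : ∃ d, i = j + (d + 1) := ⟨i - (j + 1), by omega⟩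
    rw [if_neg hij.not_gt, if_neg hij.ne] at h
    apply Exec.mono
    · apply Exec.seq
      apply exec_compareProg j (j + (d + 1)) 0 0
      rw [show j + (d + 1) - j = d + 1 by omega, show min (j + (d + 1)) j + 0 = j by omega,
        show j - (j + (d + 1)) + 0 = 0 by omega]
      apply Exec.loop none rfl
      apply Exec.loop (some true) rfl
      apply Exec.seq
      apply Exec.push
      apply Exec.seq
      apply exec_pushAll
      apply Exec.seq
      apply exec_split (by decide) (by decide) (by decide)
      apply Exec.push
      have e : ones j ++ true :: ones d = ones (j + (d + 1)) := ones_append_ones j (d + 1)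
      simpa [Store.get, Store.set, reverse_unary, e] using h
    · simp [Store.get, Store.set]; omega

/-- Write the conjunctions. -/
def conjunctionProg : Prog :=
  .loop .rem Option.isSome fun o => o.elim .nop fun _ =>
    .seq (pushAll .out [true, false, true, true, false, false]) <| .seq (split .idx .out .tmp) <|
    .seq (pour .tmp .idx) <| .seq (pushAll .out [false, false, true]) <|
    .seq (tokens splicedVarProg) <| .seq (pour .sav .inp) <| .seq (split .rem .len .tmp) <|
    .seq (pour .tmp .rem) (.push .idx true)

theorem num₂_inl {m m' : ℕ} (i : Fin m) : num₂ m m' (.inl i) = i := rfl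

theorem bits_splicedVar {m : ℕ} (i v : Fin m) :
    (splicedVar i v).bits (num₂ m (m * (m - 1) / 2)) =
      if (i : ℕ) < v then false :: false :: unary (m + pairBase m i + (v - i - 1))
        else if (v : ℕ) = i then false :: true :: false :: false :: unary i
        else false :: false :: unary v := by
  unfold splicedVar
  by_cases h : i < v
  · rw [dif_pos h, if_pos (show (i : ℕ) < v from h)]
    simp [BExpr.bits, num₂, pairIndex_val, add_assoc]
  · rw [dif_neg h, if_neg (show ¬ (i : ℕ) < v from h)]
    by_cases h' : v = i
    · simp [h', BExpr.bits, num₂]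
    · simp [h', Fin.val_inj, BExpr.bits, num₂]

/-- The loop invariant before conjunct `i`: `idx` holds `i`, `rem` the number of conjuncts left, and
`len` the number of the first variable of row `i` of `y`. The input `f` is restored after each
round, and the final pour writes `f(x)` itself as the last operand. -/
theorem exec_conjunctionProg {m : ℕ} (f : BExpr (Fin m)) (r i : ℕ) (hr : i + r = m)
    (h : Exec Ks ⟨[], ((conjunction f ((List.finRange m).drop i)).bits
        (num₂ m (m * (m - 1) / 2))).reverse ++ out, [], ones m, ones (m + m * (m - 1) / 2), [], [],
        []⟩ F n) :
    Exec (conjunctionProg :: pour .inp .out :: Ks)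
      ⟨f.bits Fin.val, out, [], ones i, ones (m + pairBase m i), ones r, [], []⟩ F
      (n + r * (40 + 12 * m + (30 + 15 * m + 5 * m ^ 2) * (f.bits Fin.val).length) +
        2 * (f.bits Fin.val).length + 4) := by
  induction r generalizing i out n with
  | zero =>
    obtain rfl : i = m := by omega
    apply Exec.mono
    · apply Exec.loop none rfl
      apply Exec.nop
      apply exec_pour (by decide)
      -- No conjunct is left. The remaining `f(x)` has the same bits as the input, since the
      -- variables of `x` keep their numbers.
      rw [List.drop_eq_nil_of_le (by simp)] at h
      have e : (f.bind fun j => BExpr.var (Sum.inl j)).bits (num₂ i (i * (i - 1) / 2)) =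
          f.bits Fin.val := by
        rw [BExpr.bits_bind]
        exact BExpr.bitsWith_unary Fin.val f
      simpa [Store.get, Store.set, pairBase_self, conjunction, e] using h
    · simp [Store.get, Store.set]
  | succ r ih =>
    have hi : i < m := by omega
    have hL : pairBase m i ≤ m * m := (pairBase_le m i).trans (Nat.mul_le_mul_right m hi.le)
    have hV : ∀ {Ks : List Prog} {inp out sav : List Bool} {F : Store} {n : ℕ} (v : Fin m),
        Exec Ks ⟨inp, ((splicedVar ⟨i, hi⟩ v).bits (num₂ m (m * (m - 1) / 2))).reverse ++ out,
          (unary v).reverse ++ sav, ones i, ones (m + pairBase m i), ones r, [], []⟩ F n →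
        Exec (splicedVarProg :: Ks) ⟨unary v ++ inp, out, sav, ones i, ones (m + pairBase m i),
          ones r, [], []⟩ F (n + (24 + 13 * m + 5 * m ^ 2)) := by
      intro Ks inp out sav F n v h
      rw [bits_splicedVar] at h
      refine (exec_splicedVarProg _ _ _ h).mono ?_
      have := v.2
      nlinarith
    apply Exec.mono
    · apply Exec.loop (some true) rfl
      apply Exec.seq
      apply exec_pushAll
      apply Exec.seq
      apply exec_split (by decide) (by decide) (by decide)
      apply Exec.seq
      apply exec_pour (by decide)
      apply Exec.seq
      apply exec_pushAll
      apply Exec.seq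
      dsimp only [Store.get, Store.set, List.tail, List.replicate]
      simp only [List.length_replicate, List.append_nil, List.reverse_replicate]
      apply exec_tokens hV f
      apply Exec.seq
      apply exec_pour (by decide)
      apply Exec.seq
      apply exec_split (by decide) (by decide) (by decide)
      apply Exec.seq
      apply exec_pour (by decide)
      apply Exec.push
      dsimp only [Store.get, Store.set]
      simp only [List.length_replicate, List.append_nil, List.reverse_replicate,
        List.reverse_reverse, ones_append_ones]
      -- After the pop, `rem` holds `r = m - 1 - i`, the length of row `i`; adding it to `len` gives
      -- the start of the next row.
      rw [show r + (m + pairBase m i) = m + pairBase m (i + 1) by rw [pairBase_succ]; omega]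
      apply ih (i + 1) (by omega)
      rw [List.drop_eq_getElem_cons (by simpa using hi)] at h
      simpa [conjunction, conjunct, BExpr.bits, BExpr.bits_bind, num₂, reverse_unary] using h
    · simp [Store.get, Store.set]
      nlinarith

/-- Read the number of variables. -/
def readSizeProg : Prog :=
  .loop .inp (fun o => o.getD false) fun o => cond (o.getD false)
    (.seq (.push .len true) (.push .rem true)) .nop

theorem exec_readSizeProg (k : ℕ)
    (h : Exec Ks ⟨inp, out, sav, idx, ones k ++ len, ones k ++ rem, tmp, aux⟩ F n) :
    Exec (readSizeProg :: Ks) ⟨unary k ++ inp, out, sav, idx, len, rem, tmp, aux⟩ F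
      (n + 3 * k + 2) := by
  induction k generalizing len rem with
  | zero =>
    apply Exec.loop (some false) rfl
    apply Exec.nop
    exact h
  | succ k ih =>
    apply Exec.mono
    · apply Exec.loop (some true) rfl
      apply Exec.seq
      apply Exec.push
      apply Exec.push
      apply ih
      simpa [List.replicate_succ, ones_append_cons, Store.get, Store.set] using h
    · omega

/-- Move as many symbols as there are in the stack `idx` from the stack `len` to the stack `tmp`. -/
def splitLenProg : Prog :=
  .loop .idx Option.isSome fun o => o.elim .nop fun _ =>
    .seq (.push .tmp true) (.loop .len (fun _ => false) fun _ => .nop)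

theorem exec_splitLenProg (k l : ℕ)
    (h : Exec Ks ⟨inp, out, sav, [], ones l, rem, ones k ++ tmp, aux⟩ F n) :
    Exec (splitLenProg :: Ks) ⟨inp, out, sav, ones k, ones (k + l), rem, tmp, aux⟩ F
      (n + 4 * k + 2) := by
  induction k generalizing tmp with
  | zero =>
    apply Exec.loop none rfl
    apply Exec.nop
    simpa [Store.get, Store.set] using h
  | succ k ih =>
    apply Exec.mono
    · apply Exec.loop (some true) rfl
      apply Exec.seq
      apply Exec.push
      rw [show k + 1 + l = k + l + 1 by omega]
      apply Exec.loop (some true) rfl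
      apply Exec.nop
      apply ih
      simpa [List.replicate_succ, ones_append_cons, Store.get, Store.set] using h
    · omega

/-- Compute the instance for the greatest solution. -/
def greatestProg : Prog :=
  .seq readSizeProg <| .seq (.seq conjunctionProg (pour .inp .out)) <|
  .seq (pour .out .inp) <| .seq (.push .inp false) <| .seq splitLenProg <|
  .seq (pour .len .inp) <| .seq (.push .inp false) (pour .tmp .inp)

theorem length_bits_conjunction_le {m : ℕ} (f : BExpr (Fin m)) (l : List (Fin m)) :
    ((conjunction f l).bits (num₂ m (m * (m - 1) / 2))).length ≤
      (l.length + 1) * (20 + 4 * m + 2 * m ^ 2) * (f.bits Fin.val).length := by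
  have hf := one_le_length_bits Fin.val f
  induction l with
  | nil =>
    have e : (f.bind fun j => BExpr.var (Sum.inl j)).bits (num₂ m (m * (m - 1) / 2)) =
        f.bits Fin.val := by
      rw [BExpr.bits_bind]
      exact BExpr.bitsWith_unary Fin.val f
    simp only [conjunction, List.foldr_nil, e, List.length_nil]
    nlinarith
  | cons i l ih =>
    have h : (f.bitsWith fun v => (splicedVar i v).bits (num₂ m (m * (m - 1) / 2))).length ≤
        (5 + 2 * m + m ^ 2) * (f.bits Fin.val).length := by
      -- Every variable number that occurs is less than `2 * m + m ^ 2`; the remaining 5 covers the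
      -- tags and the terminating zero.
      refine length_bitsWith_le (by nlinarith) (fun v => ?_) f
      have h₁ := (pairBase_le m i).trans (Nat.mul_le_mul_right m i.2.le)
      have h₂ := i.2
      have h₃ : (v - i - 1 : ℕ) ≤ v := (Nat.sub_le _ _).trans (Nat.sub_le _ _)
      rw [bits_splicedVar]
      split_ifs <;> simp only [List.length_cons, length_unary] <;> nlinarith
    have h₂ : (i : ℕ) ≤ m * (f.bits Fin.val).length := i.2.le.trans (Nat.le_mul_of_pos_right m hf)
    have e : ((conjunction f (i :: l)).bits (num₂ m (m * (m - 1) / 2))).length = i + 9 +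
        (f.bitsWith fun v => (splicedVar i v).bits (num₂ m (m * (m - 1) / 2))).length +
        ((conjunction f l).bits (num₂ m (m * (m - 1) / 2))).length := by
      rw [← BExpr.bits_bind]
      simp [conjunction, conjunct, BExpr.bits, length_unary, num₂_inl]
      omega
    rw [e, List.length_cons]
    nlinarith

/-- The degree is 4: there are `m + 1` copies of `f`, in which a variable may be replaced by one
with a number quadratic in `m`. -/
theorem computable_greatest : Nonempty (TM2ComputableInPolyTime (fun I : Inst₁ => I.code.1)
    (fun I : Inst₂ => I.code.1) Inst₁.greatest) := by
  refine computable_of_run greatestProg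
    (100 + 100 * Polynomial.X + 100 * Polynomial.X ^ 2 + 100 * Polynomial.X ^ 3 +
      100 * Polynomial.X ^ 4) fun I => ?_
  obtain ⟨m, hm, f⟩ := I
  have hlen := length_bits_conjunction_le f (List.finRange m)
  apply Exec.run
  apply Exec.mono
  · rw [Inst₁.code]
    apply Exec.seq
    apply exec_readSizeProg m
    apply Exec.seq
    apply Exec.seq
    dsimp only [Store.ofInp]
    rw [List.append_nil]
    apply exec_conjunctionProg f m 0 (by omega)
    rw [List.drop_zero, List.append_nil]
    -- The code is assembled from its end: the expression, then `m * (m - 1) / 2`, then `m`. Both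
    -- numbers come from `len`, which holds their sum.
    apply Exec.seq
    apply exec_pour (by decide)
    apply Exec.seq
    apply Exec.push
    apply Exec.seq
    apply exec_splitLenProg
    apply Exec.seq
    apply exec_pour (by decide)
    apply Exec.seq
    apply Exec.push
    apply exec_pour (by decide)
    apply Exec.nil
    simp [Store.get, Store.set, Inst₂.code, Inst₁.greatest, unary]
  · rw [length_code₁]
    simp only [List.length_finRange] at hlen
    simp [Store.get, Store.set]
    have h₁ : m * (m - 1) / 2 ≤ m * m :=
      (Nat.div_le_self _ _).trans (Nat.mul_le_mul_left m (Nat.sub_le m 1))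
    generalize (List.length (BExpr.bits _ (conjunction _ _))) = G at hlen ⊢
    generalize m * (m - 1) / 2 = q at h₁ ⊢
    generalize (BExpr.bits Fin.val f).length = B at hlen ⊢
    obtain ⟨N, hN⟩ : ∃ N, N = m + 1 + B := ⟨_, rfl⟩
    rw [← hN]
    have hm : m ≤ N := by omega
    have hB : B ≤ N := by omega
    have h₂ : G ≤ N * (20 + 4 * N + 2 * N ^ 2) * N := by
      refine hlen.trans ?_
      gcongr
      omega
    have h₃ : m * (40 + 12 * m + (30 + 15 * m + 5 * m ^ 2) * B) ≤
        N * (40 + 12 * N + (30 + 15 * N + 5 * N ^ 2) * N) := by gcongr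
    have h₄ : m * m ≤ N * N := by gcongr
    nlinarith [Nat.zero_le (N ^ 2), Nat.zero_le (N ^ 3), Nat.zero_le (N ^ 4)]

end Greatest

/-! ### Recognition of codes -/

/-- The string `s` is a sequence of `d` expressions in variables with numbers less than `B`. -/
inductive Codes (B : ℕ) : ℕ → List Bool → Prop
  | nil : Codes B 0 []
  | var {d j s} : j < B → Codes B d s → Codes B (d + 1) (false :: false :: (unary j ++ s))
  | not {d s} : Codes B (d + 1) s → Codes B (d + 1) (false :: true :: s)
  | bin {d b s} : Codes B (d + 2) s → Codes B (d + 1) (true :: b :: s)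

section Codes

variable {B d : ℕ} {s : List Bool}

theorem codes_zero : Codes B 0 s ↔ s = [] := by
  constructor
  · intro h
    cases h
    rfl
  · rintro rfl
    exact .nil

theorem not_codes_nil : ¬ Codes B (d + 1) [] := by
  intro h
  cases h

theorem not_codes_singleton {b : Bool} : ¬ Codes B (d + 1) [b] := by
  intro h
  cases h

theorem codes_bin {b : Bool} : Codes B (d + 1) (true :: b :: s) ↔ Codes B (d + 2) s := by
  constructor
  · intro h
    cases h
    assumption
  · exact .bin

theorem codes_not : Codes B (d + 1) (false :: true :: s) ↔ Codes B (d + 1) s := by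
  constructor
  · intro h
    cases h
    assumption
  · exact .not

theorem codes_var : Codes B (d + 1) (false :: false :: s) ↔
    ∃ j < B, ∃ s', s = unary j ++ s' ∧ Codes B d s' := by
  constructor
  · intro h
    cases h with
    | var hj h => exact ⟨_, hj, _, rfl, h⟩
  · rintro ⟨j, hj, s', rfl, h⟩
    exact .var hj h

theorem Codes.bits_append {V : Type} {num : V → ℕ} (hnum : ∀ v, num v < B) (e : BExpr V)
    (h : Codes B d s) : Codes B (d + 1) (e.bits num ++ s) := by
  induction e generalizing d s with
  | var v => exact .var (hnum v) h
  | not e ih => exact .not (ih h)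
  | and e₁ e₂ ih₁ ih₂ =>
    have := Codes.bin (b := false) (ih₁ (ih₂ h))
    simpa [BExpr.bits] using this
  | or e₁ e₂ ih₁ ih₂ =>
    have := Codes.bin (b := true) (ih₁ (ih₂ h))
    simpa [BExpr.bits] using this

/-- Parsing of prefix notation: an operator takes its operands from the front of the list of
expressions parsed behind it. Every number below `B` must belong to a variable. -/
theorem Codes.exists_eq {V : Type} {num : V → ℕ} (hnum : ∀ j < B, ∃ v, num v = j)
    (h : Codes B d s) : ∃ es : List (BExpr V), es.length = d ∧ s = es.flatMap (BExpr.bits num) := by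
  induction h with
  | nil => exact ⟨[], rfl, rfl⟩
  | var hj h ih =>
    obtain ⟨es, rfl, rfl⟩ := ih
    obtain ⟨v, rfl⟩ := hnum _ hj
    exact ⟨.var v :: es, rfl, by simp [BExpr.bits]⟩
  | not h ih =>
    obtain ⟨_ | ⟨e, es⟩, h₁, rfl⟩ := ih
    · cases h₁
    · exact ⟨.not e :: es, h₁, by simp [BExpr.bits]⟩
  | @bin d b s h ih =>
    obtain ⟨_ | ⟨e₁, _ | ⟨e₂, es⟩⟩, h₁, rfl⟩ := ih
    · cases h₁
    · cases h₁
    · cases b with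
      | false => exact ⟨.and e₁ e₂ :: es, by simpa using h₁, by simp [BExpr.bits]⟩
      | true => exact ⟨.or e₁ e₂ :: es, by simpa using h₁, by simp [BExpr.bits]⟩

/-- A counter of the expressions still expected thus suffices to recognise codes: a variable lowers
it, `not` keeps it, a binary operator raises it by one. -/
theorem codes_one_iff {V : Type} {num : V → ℕ} (hnum : ∀ v, num v < B)
    (hnum' : ∀ j < B, ∃ v, num v = j) : Codes B 1 s ↔ ∃ e : BExpr V, s = e.bits num := by
  constructor
  · intro h
    obtain ⟨es, h₁, rfl⟩ := h.exists_eq hnum'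
    obtain ⟨e, rfl⟩ := List.length_eq_one_iff.1 h₁
    exact ⟨e, by simp⟩
  · rintro ⟨e, rfl⟩
    simpa using Codes.nil.bits_append hnum e

theorem exists_code₁_iff {s : Str} : (∃ I : Inst₁, I.code = s) ↔
    ∃ m, 0 < m ∧ ∃ s', s.1 = unary m ++ s' ∧ Codes m 1 s' := by
  constructor
  · rintro ⟨⟨m, hm, f⟩, rfl⟩
    exact ⟨m, hm, _, rfl,
      (codes_one_iff (fun v : Fin m => v.2) fun j hj => ⟨⟨j, hj⟩, rfl⟩).2 ⟨f, rfl⟩⟩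
  · rintro ⟨m, hm, s', h, hs⟩
    obtain ⟨f, rfl⟩ :=
      (codes_one_iff (fun v : Fin m => v.2) fun j hj => ⟨⟨j, hj⟩, rfl⟩).1 hs
    exact ⟨⟨m, hm, f⟩, Subtype.ext h.symm⟩

theorem num₂_lt {m m' : ℕ} (v : Fin m ⊕ Fin m') : num₂ m m' v < m + m' := by
  rcases v with ⟨i, hi⟩ | ⟨j, hj⟩ <;> simp [num₂] <;> omega

theorem exists_num₂_eq {m m' j : ℕ} (hj : j < m + m') : ∃ v, num₂ m m' v = j := by
  by_cases h : j < m
  · exact ⟨.inl ⟨j, h⟩, rfl⟩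
  · exact ⟨.inr ⟨j - m, by omega⟩, by simp [num₂]; omega⟩

theorem exists_code₂_iff {s : Str} : (∃ I : Inst₂, I.code = s) ↔
    ∃ m, 0 < m ∧ ∃ m' s', s.1 = unary m ++ (unary m' ++ s') ∧ Codes (m + m') 1 s' := by
  constructor
  · rintro ⟨⟨m, m', hm, f⟩, rfl⟩
    exact ⟨m, hm, m', _, rfl, (codes_one_iff num₂_lt fun j => exists_num₂_eq).2 ⟨f, rfl⟩⟩
  · rintro ⟨m, hm, m', s', h, hs⟩
    obtain ⟨f, rfl⟩ := (codes_one_iff (V := Fin m ⊕ Fin m') num₂_lt fun j => exists_num₂_eq).1 hs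
    exact ⟨⟨m, m', hm, f⟩, Subtype.ext h.symm⟩

theorem eq_unary_append_or_eq_ones (s : List Bool) :
    (∃ j s', s = unary j ++ s') ∨ ∃ j, s = ones j := by
  induction s with
  | nil => exact .inr ⟨0, rfl⟩
  | cons b s ih =>
    cases b with
    | false => exact .inl ⟨0, s, rfl⟩
    | true =>
      rcases ih with ⟨j, s', rfl⟩ | ⟨j, rfl⟩
      · exact .inl ⟨j + 1, s', rfl⟩
      · exact .inr ⟨j + 1, rfl⟩

end Codes

/-! ### Programs that recognise codes and replace other strings -/

section Scan

variable {Ks : List Prog} {F : Store} {n : ℕ} {inp out sav idx len rem tmp aux : List Bool}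

theorem exec_compareProg_ones (j i t a : ℕ)
    (h : Exec Ks ⟨[], out, ones j ++ sav, ones (i - j), len, rem, ones (min i j + t),
      ones (j - i + a + 1)⟩ F n) :
    Exec (compareProg :: Ks) ⟨ones j, out, sav, ones i, len, rem, ones t, ones a⟩ F
      (n + 4 * j + 2) := by
  induction j generalizing i t a sav with
  | zero =>
    apply Exec.loop none rfl
    apply Exec.push
    simpa [List.replicate_succ, Store.get, Store.set] using h
  | succ j ih =>
    apply Exec.mono
    · apply Exec.loop (some true) rfl
      apply Exec.seq
      apply Exec.push
      cases i with
      | zero =>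
        apply Exec.loop none rfl
        apply Exec.push
        apply ih 0 t (a + 1)
        simpa [List.replicate_succ, ones_append_cons, add_assoc, add_comm a 1, Store.get,
          Store.set] using h
      | succ i =>
        apply Exec.loop (some true) rfl
        apply Exec.push
        apply ih i (t + 1) a
        simpa [List.replicate_succ, ones_append_cons, add_assoc, add_comm t 1, Store.get,
          Store.set] using h
    · omega

/-- Read the number of a variable and check that it is less than the number in the stack `idx`. If
not, then push something on the stack `aux`. -/
def checkVarProg : Prog :=
  .seq compareProg <| .seq (.loop .idx (fun _ => false) fun o =>
    cond o.isSome (.push .idx true) (.push .aux true)) (pour .tmp .idx)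

theorem exec_checkVarProg_of_lt {j B a : ℕ} (hj : j < B)
    (h : Exec Ks ⟨inp, out, (unary j).reverse ++ sav, ones B, len, rem, [], ones a⟩ F n) :
    Exec (checkVarProg :: Ks) ⟨unary j ++ inp, out, sav, ones B, len, rem, [], ones a⟩ F
      (n + (6 * j + 6)) := by
  obtain ⟨d, rfl⟩ : ∃ d, B = j + (d + 1) := ⟨B - (j + 1), by omega⟩
  apply Exec.mono
  · apply Exec.seq
    apply exec_compareProg j (j + (d + 1)) 0 a
    rw [show j + (d + 1) - j = d + 1 by omega, show min (j + (d + 1)) j + 0 = j by omega,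
      show j - (j + (d + 1)) + a = a by omega]
    apply Exec.seq
    apply Exec.loop (some true) rfl
    apply Exec.push
    apply exec_pour (by decide)
    have e : ones j ++ true :: ones d = ones (j + (d + 1)) := ones_append_ones j (d + 1)
    simpa [Store.get, Store.set, e] using h
  · simp [Store.get, Store.set]; omega

/-- The number is too large or not terminated. What is left behind is irrelevant then, except that
`aux` has grown and that the lengths stay bounded, which is needed for the running time. -/
theorem exec_checkVarProg_of_not {s : List Bool} {B : ℕ}
    (hs : ∀ j < B, ∀ s', s ≠ unary j ++ s') (a : ℕ) :
    ∃ s' w a', s'.length + w.length ≤ s.length ∧ a < a' ∧ a' ≤ a + s.length + 2 ∧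
      ∀ {Ks out sav len rem F n},
        Exec Ks ⟨s', out, w ++ sav, ones B, len, rem, [], ones a'⟩ F n →
        Exec (checkVarProg :: Ks) ⟨s, out, sav, ones B, len, rem, [], ones a⟩ F
          (n + (6 * s.length + 8)) := by
  rcases eq_unary_append_or_eq_ones s with ⟨j, s', rfl⟩ | ⟨j, rfl⟩
  · have hj : B ≤ j := by
      by_contra h
      exact hs j (by omega) s' rfl
    refine ⟨s', (unary j).reverse, j - B + a + 1, ?_, by omega, ?_, ?_⟩
    · simp [add_comm]
    · simp only [List.length_append, length_unary]; omega
    · intro Ks out sav len rem F n h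
      apply Exec.mono
      · apply Exec.seq
        apply exec_compareProg j B 0 a
        rw [show B - j = 0 by omega, show min B j + 0 = B by omega]
        apply Exec.seq
        apply Exec.loop none rfl
        apply Exec.push
        apply exec_pour (by decide)
        simpa [Store.get, Store.set, List.replicate_succ] using h
      · simp [Store.get, Store.set, length_unary]; omega
  · by_cases hj : j < B
    · obtain ⟨d, rfl⟩ : ∃ d, B = j + (d + 1) := ⟨B - (j + 1), by omega⟩
      refine ⟨[], ones j, j - (j + (d + 1)) + a + 1, by simp, by omega, by omega, ?_⟩
      intro Ks out sav len rem F n h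
      apply Exec.mono
      · apply Exec.seq
        apply exec_compareProg_ones j (j + (d + 1)) 0 a
        rw [show j + (d + 1) - j = d + 1 by omega, show min (j + (d + 1)) j + 0 = j by omega]
        apply Exec.seq
        apply Exec.loop (some true) rfl
        apply Exec.push
        apply exec_pour (by decide)
        have e : ones j ++ true :: ones d = ones (j + (d + 1)) := ones_append_ones j (d + 1)
        simpa [Store.get, Store.set, e] using h
      · simp [Store.get, Store.set]; omega
    · refine ⟨[], ones j, j - B + a + 2, by simp, by omega, by simp; omega, ?_⟩
      intro Ks out sav len rem F n h
      apply Exec.mono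
      · apply Exec.seq
        apply exec_compareProg_ones j B 0 a
        rw [show B - j = 0 by omega, show min B j + 0 = B by omega]
        apply Exec.seq
        apply Exec.loop none rfl
        apply Exec.push
        apply exec_pour (by decide)
        simpa [Store.get, Store.set, List.replicate_succ] using h
      · simp [Store.get, Store.set]; omega

/-- Read as many expressions as there are symbols in the stack `rem`. If this is not possible, then
push something on the stack `aux`. -/
def scanProg : Prog :=
  .loop .rem Option.isSome fun o => o.elim .nop fun _ =>
    .loop .inp (fun _ => false) fun o => o.elim (.push .aux true) fun b₁ =>
      .seq (.push .sav b₁) <| .loop .inp (fun _ => false) fun o => o.elim (.push .aux true) fun b₂ =>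
        .seq (.push .sav b₂) <| cond b₁ (.seq (.push .rem true) (.push .rem true)) <|
          cond b₂ (.push .rem true) checkVarProg

/-- The program `scanProg` works properly within `c` steps. -/
def Scan (B c : ℕ) (s : List Bool) (d : ℕ) (sav : List Bool) (a : ℕ) : Prop :=
  ∃ s' sav' a', s'.length ≤ s.length ∧ sav'.length ≤ sav.length + s.length ∧ a' ≤ a + c ∧
    (a = 0 → Codes B d s → a' = 0 ∧ s' = [] ∧ sav' = s.reverse ++ sav) ∧
    (a' = 0 → s' = [] → a = 0 ∧ Codes B d s) ∧
    ∀ {Ks F n}, Exec Ks ⟨s', [], sav', ones B, [], [], [], ones a'⟩ F n →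
      Exec (scanProg :: Ks) ⟨s, [], sav, ones B, [], ones d, [], ones a⟩ F (n + c)

theorem Scan.step {B c k : ℕ} {s s₁ sav sav₁ : List Bool} {d d₁ a a₁ : ℕ}
    (h : Scan B c s₁ d₁ sav₁ a₁) (hs : s₁.length ≤ s.length)
    (hsav : sav₁.length + s₁.length ≤ sav.length + s.length) (ha : a₁ ≤ a + k)
    (h₁ : a = 0 → Codes B d s → a₁ = 0 ∧ Codes B d₁ s₁ ∧ s₁.reverse ++ sav₁ = s.reverse ++ sav)
    (h₂ : a₁ = 0 → Codes B d₁ s₁ → a = 0 ∧ Codes B d s)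
    (hx : ∀ {Ks F n},
      Exec (scanProg :: Ks) ⟨s₁, [], sav₁, ones B, [], ones d₁, [], ones a₁⟩ F n →
      Exec (scanProg :: Ks) ⟨s, [], sav, ones B, [], ones d, [], ones a⟩ F (n + k)) :
    Scan B (c + k) s d sav a := by
  obtain ⟨s', sav', a', g₁, g₂, g₃, g₄, g₅, g₆⟩ := h
  refine ⟨s', sav', a', g₁.trans hs, g₂.trans hsav, by omega, fun h₀ hc => ?_, fun h₀ hc => ?_,
    fun h => ?_⟩
  · obtain ⟨e₁, e₂, e₃⟩ := h₁ h₀ hc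
    rw [← e₃]
    exact g₄ e₁ e₂
  · obtain ⟨e₁, e₂⟩ := g₅ h₀ hc
    exact h₂ e₁ e₂
  · have := hx (g₆ h)
    rwa [add_assoc] at this

theorem Scan.mono {B c c' : ℕ} {s sav : List Bool} {d a : ℕ} (h : Scan B c s d sav a)
    (hc : c ≤ c') : Scan B c' s d sav a := by
  obtain ⟨s', sav', a', g₁, g₂, g₃, g₄, g₅, g₆⟩ := h
  exact ⟨s', sav', a', g₁, g₂, by omega, g₄, g₅, fun h => (g₆ h).mono (by omega)⟩

/-- Each round lowers `2 * s.length + d`: a binary operator raises `d` by one but consumes two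
symbols, and any other round consumes input or lowers `d`. Scanning continues after an error, but
`aux` never shrinks, so the error is not forgotten. A round costs at most `20 + 6 * M` steps. -/
theorem scan (B M N : ℕ) (s : List Bool) (d : ℕ) (sav : List Bool) (a : ℕ)
    (hN : 2 * s.length + d ≤ N) (hM : s.length ≤ M) :
    Scan B ((20 + 6 * M) * N + 2) s d sav a := by
  induction N generalizing s d sav a with
  | zero =>
    obtain rfl : s = [] := List.eq_nil_of_length_eq_zero (by omega)
    obtain rfl : d = 0 := by omega
    refine ⟨[], sav, a, le_rfl, by simp, by omega, fun h _ => ⟨h, rfl, rfl⟩, fun h _ => ⟨h, .nil⟩,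
      fun h => ?_⟩
    apply Exec.mono
    · apply Exec.loop none rfl
      apply Exec.nop
      exact h
    · omega
  | succ N ih =>
    cases d with
    | zero =>
      refine ⟨s, sav, a, le_rfl, by simp, by omega, fun h hc => ?_, fun h hs => ⟨h, ?_⟩,
        fun h => ?_⟩
      · rw [codes_zero] at hc
        subst hc
        exact ⟨h, rfl, rfl⟩
      · rwa [codes_zero]
      · apply Exec.mono
        · apply Exec.loop none rfl
          apply Exec.nop
          exact h
        · omega
    | succ d =>
      rcases s with _ | ⟨b₁, _ | ⟨b₂, s⟩⟩
      · refine ((ih [] d sav (a + 1) (by simp at hN ⊢; omega) (by simp)).step (s := [])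
          (d := d + 1) (sav := sav) (a := a) (k := 3) le_rfl le_rfl (by omega)
          (fun _ hc => absurd hc not_codes_nil) (fun h => absurd h (by omega))
          fun h => ?_).mono (by rw [Nat.mul_succ]; omega)
        apply Exec.loop (some true) rfl
        apply Exec.loop none rfl
        apply Exec.push
        exact h
      · refine ((ih [] d (b₁ :: sav) (a + 1) (by simp at hN ⊢; omega) (by simp)).step (s := [b₁])
          (d := d + 1) (sav := sav) (a := a) (k := 5) (by simp) (by simp) (by omega)
          (fun _ hc => absurd hc not_codes_singleton) (fun h => absurd h (by omega))
          fun h => ?_).mono (by rw [Nat.mul_succ]; omega)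
        apply Exec.loop (some true) rfl
        apply Exec.loop (some b₁) rfl
        apply Exec.seq
        apply Exec.push
        apply Exec.loop none rfl
        apply Exec.push
        exact h
      · simp only [List.length_cons] at hN hM
        cases b₁ with
        | true =>
          refine ((ih s (d + 2) (b₂ :: true :: sav) a (by omega) (by omega)).step
            (s := true :: b₂ :: s) (d := d + 1) (sav := sav) (a := a) (k := 7) (by simp; omega)
            (by simp; omega) (by omega) (fun h hc => ⟨h, codes_bin.1 hc, by simp⟩)
            (fun h hc => ⟨h, codes_bin.2 hc⟩) fun h => ?_).mono (by rw [Nat.mul_succ]; omega)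
          apply Exec.loop (some true) rfl
          apply Exec.loop (some true) rfl
          apply Exec.seq
          apply Exec.push
          apply Exec.loop (some b₂) rfl
          apply Exec.seq
          apply Exec.push
          apply Exec.seq
          apply Exec.push
          apply Exec.push
          exact h
        | false =>
          cases b₂ with
          | true =>
            refine ((ih s (d + 1) (true :: false :: sav) a (by omega) (by omega)).step
              (s := false :: true :: s) (d := d + 1) (sav := sav) (a := a) (k := 6)
              (by simp; omega) (by simp; omega) (by omega)
              (fun h hc => ⟨h, codes_not.1 hc, by simp⟩)
              (fun h hc => ⟨h, codes_not.2 hc⟩) fun h => ?_).mono (by rw [Nat.mul_succ]; omega)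
            apply Exec.loop (some true) rfl
            apply Exec.loop (some false) rfl
            apply Exec.seq
            apply Exec.push
            apply Exec.loop (some true) rfl
            apply Exec.seq
            apply Exec.push
            apply Exec.push
            exact h
          | false =>
            by_cases hs : ∃ j < B, ∃ s', s = unary j ++ s'
            · obtain ⟨j, hj, s', rfl⟩ := hs
              simp only [List.length_append, length_unary] at hN hM
              refine ((ih s' d ((unary j).reverse ++ (false :: false :: sav)) a (by omega)
                (by omega)).step (s := false :: false :: (unary j ++ s')) (d := d + 1)
                (sav := sav) (a := a) (k := 6 * j + 6 + 5) (by simp; omega)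
                (by simp; omega) (by omega) (fun h hc => ⟨h, ?_, by simp⟩)
                (fun h hc => ⟨h, .var hj hc⟩) fun h => ?_).mono (by rw [Nat.mul_succ]; omega)
              · obtain ⟨j', _, s'', e, hc'⟩ := codes_var.1 hc
                rwa [(unary_append_inj e).2]
              apply Exec.loop (some true) rfl
              apply Exec.loop (some false) rfl
              apply Exec.seq
              apply Exec.push
              apply Exec.loop (some false) rfl
              apply Exec.seq
              apply Exec.push
              apply exec_checkVarProg_of_lt hj
              exact h
            · obtain ⟨s', w, a', g₁, g₂, g₃, g₄⟩ := exec_checkVarProg_of_not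
                (fun j hj s' e => hs ⟨j, hj, s', e⟩) a
              refine ((ih s' d (w ++ (false :: false :: sav)) a' (by omega)
                (by omega)).step (s := false :: false :: s) (d := d + 1)
                (sav := sav) (a := a) (k := 6 * s.length + 8 + 5) (by simp; omega)
                (by simp; omega) (by omega) (fun h hc => ?_)
                (fun h => absurd h (by omega)) fun h => ?_).mono (by rw [Nat.mul_succ]; omega)
              · obtain ⟨j', hj', s'', e, _⟩ := codes_var.1 hc
                exact absurd ⟨j', hj', s'', e⟩ hs
              apply Exec.loop (some true) rfl
              apply Exec.loop (some false) rfl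
              apply Exec.seq
              apply Exec.push
              apply Exec.loop (some false) rfl
              apply Exec.seq
              apply Exec.push
              apply g₄
              exact h

/-- Check that the input has been read, and that the stack `aux` is empty. If so, then restore the
input from the stack `sav`, and otherwise replace it by `l`. -/
def restoreProg (l : List Bool) : Prog :=
  .seq (.loop .inp (fun _ => false) fun o => o.elim .nop fun _ => .push .aux true) <|
  .seq (drain .inp) <| .seq (drain .idx) <| .loop .aux (fun _ => false) fun o =>
    cond o.isSome (.seq (drain .aux) <| .seq (drain .sav) (pushAll .inp l.reverse)) (pour .sav .inp)

theorem exec_restoreProg (l : List Bool) (B a : ℕ)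
    (h : Exec Ks (.ofInp (if a = 0 ∧ inp = [] then sav.reverse else l)) F n) :
    Exec (restoreProg l :: Ks) ⟨inp, [], sav, ones B, [], [], [], ones a⟩ F
      (n + (2 * inp.length + 2 * sav.length + 2 * B + 2 * a + l.length + 20)) := by
  cases inp with
  | nil =>
    cases a with
    | zero =>
      apply Exec.mono
      · apply Exec.seq
        apply Exec.loop none rfl
        apply Exec.nop
        apply Exec.seq
        apply exec_drain
        apply Exec.seq
        apply exec_drain
        apply Exec.loop none rfl
        apply exec_pour (by decide)
        simpa [Store.get, Store.set, Store.ofInp] using h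
      · simp [Store.get, Store.set]; omega
    | succ a =>
      apply Exec.mono
      · apply Exec.seq
        apply Exec.loop none rfl
        apply Exec.nop
        apply Exec.seq
        apply exec_drain
        apply Exec.seq
        apply exec_drain
        apply Exec.loop (some true) rfl
        apply Exec.seq
        apply exec_drain
        apply Exec.seq
        apply exec_drain
        apply exec_pushAll
        simpa [Store.get, Store.set, Store.ofInp] using h
      · simp [Store.get, Store.set]; omega
  | cons b inp =>
    apply Exec.mono
    · apply Exec.seq
      apply Exec.loop (some b) rfl
      apply Exec.push
      apply Exec.seq
      apply exec_drain
      apply Exec.seq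
      apply exec_drain
      apply Exec.loop (some true) rfl
      apply Exec.seq
      apply exec_drain
      apply Exec.seq
      apply exec_drain
      apply exec_pushAll
      simpa [Store.get, Store.set, Store.ofInp] using h
    · simp [Store.get, Store.set]; omega

/-- Read a number in unary, with at least one digit one. -/
def readPosProg : Prog :=
  .loop .inp (fun _ => false) fun o =>
    cond (o.getD false) (.seq (.push .sav true) (.push .idx true)) (.push .aux true)

/-- Read a number in unary and add it to the number in the stack `idx`. -/
def readAddProg : Prog :=
  .loop .inp (fun o => o.getD false) fun o => o.elim .nop fun b =>
    .seq (.push .sav b) (cond b (.push .idx true) .nop)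

theorem exec_readAddProg_unary (j B : ℕ)
    (h : Exec Ks ⟨inp, out, (unary j).reverse ++ sav, ones (B + j), len, rem, tmp, aux⟩ F n) :
    Exec (readAddProg :: Ks) ⟨unary j ++ inp, out, sav, ones B, len, rem, tmp, aux⟩ F
      (n + 3 * j + 3) := by
  induction j generalizing B sav with
  | zero =>
    apply Exec.loop (some false) rfl
    apply Exec.seq
    apply Exec.push
    apply Exec.nop
    simpa [unary_zero, Store.get, Store.set] using h
  | succ j ih =>
    apply Exec.mono
    · apply Exec.loop (some true) rfl
      apply Exec.seq
      apply Exec.push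
      apply Exec.push
      apply ih (B + 1)
      simpa [unary_succ, add_assoc, add_comm 1 j, Store.get, Store.set] using h
    · omega

theorem exec_readAddProg_ones (j B : ℕ)
    (h : Exec Ks ⟨[], out, ones j ++ sav, ones (B + j), len, rem, tmp, aux⟩ F n) :
    Exec (readAddProg :: Ks) ⟨ones j, out, sav, ones B, len, rem, tmp, aux⟩ F
      (n + 3 * j + 3) := by
  induction j generalizing B sav with
  | zero =>
    apply Exec.mono
    · apply Exec.loop none rfl
      apply Exec.nop
      simpa [Store.get, Store.set] using h
    · omega
  | succ j ih =>
    apply Exec.mono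
    · apply Exec.loop (some true) rfl
      apply Exec.seq
      apply Exec.push
      apply Exec.push
      apply ih (B + 1)
      simpa [List.replicate_succ, ones_append_cons, add_assoc, add_comm 1 j, Store.get,
        Store.set] using h
    · omega

/-- An unterminated number needs no mark: it exhausts the input, and the empty rest is rejected
later because one expression is still expected. -/
theorem exists_exec_readAddProg (s : List Bool) : ∃ j w s', s = w ++ s' ∧ j ≤ s.length ∧
    (w = unary j ∨ s' = [] ∧ ∀ j s'', s ≠ unary j ++ s'') ∧
    ∀ {Ks out sav B len rem tmp aux F n},
      Exec Ks ⟨s', out, w.reverse ++ sav, ones (B + j), len, rem, tmp, aux⟩ F n →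
      Exec (readAddProg :: Ks) ⟨s, out, sav, ones B, len, rem, tmp, aux⟩ F
        (n + (3 * s.length + 3)) := by
  rcases eq_unary_append_or_eq_ones s with ⟨j, s', rfl⟩ | ⟨j, rfl⟩
  · refine ⟨j, unary j, s', rfl, ?_, .inl rfl, fun h => ?_⟩
    · simp only [List.length_append, length_unary]; omega
    · refine (exec_readAddProg_unary j _ h).mono ?_
      simp only [List.length_append, length_unary]; omega
  · refine ⟨j, ones j, [], by simp, by simp, .inr ⟨rfl, fun k s'' e => ?_⟩, fun h => ?_⟩
    · have : false ∈ ones j := by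
        rw [e]
        simp [unary]
      simp at this
    · rw [List.reverse_replicate] at h
      exact (exec_readAddProg_ones j _ h).mono (by simp; omega)

/-- The program `H` reads the head of the input. If the input has the property `P` then what is left
is an expression, and otherwise it is not, or the stack `aux` is not empty. -/
def ReadsHead (H : Prog) (c : ℕ) (P : List Bool → Prop) : Prop :=
  ∀ s, ∃ s' sav B a, s'.length ≤ s.length ∧ sav.length ≤ s.length ∧ B ≤ 2 * s.length ∧ a ≤ 1 ∧
    (P s ↔ a = 0 ∧ Codes B 1 s') ∧ (P s → s'.reverse ++ sav = s.reverse) ∧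
    ∀ {Ks F n}, Exec Ks ⟨s', [], sav, ones B, [], [], [], ones a⟩ F n →
      Exec (H :: Ks) (.ofInp s) F (n + (c * s.length + c))

/-- Replace the input by `l` if it is not a code with the head that `H` reads. -/
def normalizeProg (H : Prog) (l : List Bool) : Prog :=
  .seq H <| .seq (.push .rem true) <| .seq scanProg (restoreProg l)

-- Since the scan copies what it reads to `sav`, a valid input can be restored. Its time bound
-- appears three times: once for the scan, and twice because `aux` may grow by as much and is
-- emptied at two steps per symbol.
open Classical in
theorem exec_normalizeProg {H : Prog} {c : ℕ} {P : List Bool → Prop} (hH : ReadsHead H c P)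
    (l s : List Bool) :
    Exec [normalizeProg H l] (.ofInp s) (.ofInp (if P s then s else l))
      (3 * ((20 + 6 * s.length) * (2 * s.length + 1) + 2) + (c + 10) * s.length + c + l.length +
        30) := by
  obtain ⟨s₁, sav₁, B, a, g₁, g₂, g₃, g₄, g₅, g₆, g₇⟩ := hH s
  obtain ⟨s', sav', a', k₁, k₂, k₃, k₄, k₅, k₆⟩ :=
    scan B s.length (2 * s.length + 1) s₁ 1 sav₁ a (by omega) g₁
  apply Exec.mono
  · apply Exec.seq
    apply g₇
    apply Exec.seq
    apply Exec.push
    apply Exec.seq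
    apply k₆
    apply exec_restoreProg
    apply Exec.nil
    congr 1
    by_cases hs : P s
    · obtain ⟨e₁, e₂⟩ := g₅.1 hs
      obtain ⟨e₃, e₄, e₅⟩ := k₄ e₁ e₂
      rw [if_pos ⟨e₃, e₄⟩, if_pos hs, e₅, g₆ hs, List.reverse_reverse]
    · rw [if_neg hs, if_neg fun h => hs (g₅.2 (k₅ h.1 h.2))]
  · nlinarith

/-- The first digit is treated separately to enforce `m ≥ 1`: if it is not a one, then `aux` is
marked. -/
theorem exists_exec_readPosProg (s : List Bool) : ∃ s' sav B a, s'.length ≤ s.length ∧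
    sav.length + s'.length ≤ s.length ∧ B ≤ s.length ∧ a ≤ 1 ∧
    ((0 < B ∧ s = unary B ++ s' ∧ a = 0 ∧ sav = (unary B).reverse) ∨
      ((∀ m > 0, ∀ s'', s ≠ unary m ++ s'') ∧ (a = 1 ∨ s' = []))) ∧
    ∀ {Ks F n}, Exec Ks ⟨s', [], sav, ones B, [], [], [], ones a⟩ F n →
      Exec (readPosProg :: readAddProg :: Ks) (.ofInp s) F (n + (3 * s.length + 6)) := by
  rcases s with _ | ⟨b, s⟩
  · refine ⟨[], [], 0, 1, le_rfl, by simp, le_rfl, le_rfl, .inr ⟨fun m _ s'' e => ?_, .inl rfl⟩,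
      fun h => ?_⟩
    · simp [unary] at e
    · apply Exec.mono
      · apply Exec.loop none rfl
        apply Exec.push
        exact exec_readAddProg_ones 0 0 h
      · simp
  · obtain ⟨j, w, s', rfl, hj, hw, hx⟩ := exists_exec_readAddProg s
    simp only [List.length_append] at hj hx
    cases b with
    | false =>
      refine ⟨s', w.reverse, j, 1, by simp; omega, by simp, by simp; omega, le_rfl,
        .inr ⟨fun m hm s'' e => ?_, .inl rfl⟩, fun h => ?_⟩
      · obtain ⟨m, rfl⟩ : ∃ k, m = k + 1 := ⟨m - 1, by omega⟩
        simp [unary_succ] at e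
      · apply Exec.mono
        · apply Exec.loop (some false) rfl
          apply Exec.push
          apply hx (B := 0)
          simpa [Store.get, Store.set, Store.ofInp] using h
        · simp; omega
    | true =>
      refine ⟨s', w.reverse ++ [true], j + 1, 0, by simp; omega, by simp; omega, by simp; omega,
        zero_le_one, ?_, fun h => ?_⟩
      · rcases hw with rfl | ⟨rfl, hw⟩
        · exact .inl ⟨Nat.succ_pos _, rfl, rfl, by simp [unary_succ]⟩
        · refine .inr ⟨fun m hm s'' e => ?_, .inr rfl⟩
          obtain ⟨m, rfl⟩ : ∃ k, m = k + 1 := ⟨m - 1, by omega⟩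
          rw [unary_succ, List.cons_append, List.cons.injEq] at e
          exact hw m s'' e.2
      · apply Exec.mono
        · apply Exec.loop (some true) rfl
          apply Exec.seq
          apply Exec.push
          apply Exec.push
          apply hx (B := 1)
          simpa [Store.get, Store.set, Store.ofInp, add_comm 1 j] using h
        · simp; omega

theorem readsHead_one : ReadsHead (.seq readPosProg readAddProg) 6
    (fun s => ∃ m, 0 < m ∧ ∃ s', s = unary m ++ s' ∧ Codes m 1 s') := by
  intro s
  obtain ⟨s', sav, B, a, g₁, g₂, g₃, g₄, g₅, g₆⟩ := exists_exec_readPosProg s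
  refine ⟨s', sav, B, a, g₁, by omega, by omega, g₄, ?_, ?_, fun h => ?_⟩
  · rcases g₅ with ⟨h₁, rfl, h₃, h₄⟩ | ⟨h₁, h₂⟩
    · constructor
      · rintro ⟨m, hm, s'', e, hs⟩
        obtain ⟨rfl, rfl⟩ := unary_append_inj e
        exact ⟨h₃, hs⟩
      · exact fun h => ⟨B, h₁, s', rfl, h.2⟩
    · constructor
      · rintro ⟨m, hm, s'', e, hs⟩
        exact absurd e (h₁ m hm s'')
      · rintro ⟨h₃, h₄⟩
        rcases h₂ with h₂ | rfl
        · omega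
        · exact absurd h₄ not_codes_nil
  · rintro ⟨m, hm, s'', e, hs⟩
    rcases g₅ with ⟨h₁, rfl, h₃, rfl⟩ | ⟨h₁, h₂⟩
    · simp
    · exact absurd e (h₁ m hm s'')
  · apply Exec.mono
    · apply Exec.seq
      exact g₆ h
    · omega

theorem readsHead_two : ReadsHead (.seq (.seq readPosProg readAddProg) readAddProg) 9
    (fun s => ∃ m, 0 < m ∧ ∃ m' s', s = unary m ++ (unary m' ++ s') ∧ Codes (m + m') 1 s') := by
  intro s
  obtain ⟨s₁, sav, B, a, g₁, g₂, g₃, g₄, g₅, g₆⟩ := exists_exec_readPosProg s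
  obtain ⟨j, w, s', rfl, hj, hw, hx⟩ := exists_exec_readAddProg s₁
  simp only [List.length_append] at g₁ g₂ hj hx
  refine ⟨s', w.reverse ++ sav, B + j, a, by omega, by simp; omega, by omega, g₄, ?_, ?_,
    fun h => ?_⟩
  · rcases g₅ with ⟨h₁, rfl, h₃, h₄⟩ | ⟨h₁, h₂⟩
    · constructor
      · rintro ⟨m, hm, m', s'', e, hs⟩
        obtain ⟨rfl, e'⟩ := unary_append_inj e
        rcases hw with rfl | ⟨rfl, hw⟩
        · obtain ⟨rfl, rfl⟩ := unary_append_inj e'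
          exact ⟨h₃, hs⟩
        · exact absurd e' (hw _ _)
      · rintro ⟨-, h⟩
        rcases hw with rfl | ⟨rfl, hw⟩
        · exact ⟨B, h₁, j, s', rfl, h⟩
        · exact absurd h not_codes_nil
    · constructor
      · rintro ⟨m, hm, m', s'', e, hs⟩
        exact absurd e (h₁ m hm _)
      · rintro ⟨h₃, h₄⟩
        rcases h₂ with h₂ | h₂
        · omega
        · rw [(List.append_eq_nil_iff.1 h₂).2] at h₄
          exact absurd h₄ not_codes_nil
  · rintro ⟨m, hm, m', s'', e, hs⟩
    rcases g₅ with ⟨h₁, rfl, h₃, rfl⟩ | ⟨h₁, h₂⟩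
    · simp
    · exact absurd e (h₁ m hm _)
  · apply Exec.mono
    · apply Exec.seq
      apply Exec.seq
      apply g₆
      apply hx
      exact h
    · omega

open Classical in
/-- The instance with a given code, or a default instance if there is none. -/
noncomputable def decode {ι : Type} (code : ι → Str) (I₀ : ι) (s : Str) : ι :=
  if h : ∃ I, code I = s then h.choose else I₀

theorem decode_code {ι : Type} {code : ι → Str} (hc : Function.Injective code) (I₀ I : ι) :
    decode code I₀ (code I) = I := by
  have h : ∃ J, code J = code I := ⟨I, rfl⟩
  rw [decode, dif_pos h]
  exact hc h.choose_spec

theorem decode_of_not {ι : Type} {code : ι → Str} {I₀ : ι} {s : Str} (h : ¬ ∃ I, code I = s) :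
    decode code I₀ s = I₀ :=
  dif_neg h

open Classical in
theorem code_decode {ι : Type} (code : ι → Str) (I₀ : ι) (s : Str) :
    (code (decode code I₀ s)).1 = if ∃ I, code I = s then s.1 else (code I₀).1 := by
  by_cases h : ∃ I, code I = s
  · rw [if_pos h, decode, dif_pos h, h.choose_spec]
  · rw [if_neg h, decode_of_not h]

-- Although `decode` is defined by choice, on the level of strings it only keeps a code and replaces
-- anything else by the code of `I₀`.
open Classical in
theorem computable_decode {ι : Type} {code : ι → Str} (I₀ : ι) {H : Prog} {c : ℕ}
    {P : List Bool → Prop} (hH : ReadsHead H c P) (hP : ∀ s, (∃ I, code I = s) ↔ P s.1) :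
    Nonempty (TM2ComputableInPolyTime (Subtype.val : Str → List Bool) (fun I => (code I).1)
      (decode code I₀)) := by
  refine computable_of_run (normalizeProg H (code I₀).1)
    (3 * ((20 + 6 * Polynomial.X) * (2 * Polynomial.X + 1) + 2) +
      Polynomial.C (c + 10) * Polynomial.X + Polynomial.C c + Polynomial.C (code I₀).1.length + 30)
    fun s => ?_
  apply Exec.run
  have := exec_normalizeProg hH (code I₀).1 s.1
  have e : (code (decode code I₀ s)).1 = if P s.1 then s.1 else (code I₀).1 :=
    (code_decode code I₀ s).trans (if_congr (hP s) rfl rfl)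
  rw [e]
  convert this using 1
  simp [Polynomial.eval_mul, Polynomial.eval_add]

theorem computable_decode₁ (I₀ : Inst₁) : Nonempty (TM2ComputableInPolyTime
    (Subtype.val : Str → List Bool) (fun I : Inst₁ => I.code.1) (decode Inst₁.code I₀)) :=
  computable_decode I₀ readsHead_one fun _ => exists_code₁_iff

theorem computable_decode₂ (I₀ : Inst₂) : Nonempty (TM2ComputableInPolyTime
    (Subtype.val : Str → List Bool) (fun I : Inst₂ => I.code.1) (decode Inst₂.code I₀)) :=
  computable_decode I₀ readsHead_two fun _ => exists_code₂_iff

end Scan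

/-! ### Reductions -/

theorem polyTime_of_comp {μ₁ μ₂ : Str → Str} (h₁ : PolyTime μ₁) (h₂ : PolyTime μ₂) :
    PolyTime (μ₂ ∘ μ₁) :=
  computable_comp h₁ h₂

theorem StronglyReduces.trans {φ₁ φ₂ φ₃ : PromiseProblem} (h₁ : φ₁ ∝ φ₂) (h₂ : φ₂ ∝ φ₃) :
    φ₁ ∝ φ₃ := by
  obtain ⟨μ₁, hμ₁, h₁⟩ := h₁
  obtain ⟨μ₂, hμ₂, h₂⟩ := h₂
  exact ⟨μ₂ ∘ μ₁, polyTime_of_comp hμ₁ hμ₂, fun s => (h₂ (μ₁ s)).trans (h₁ s)⟩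

theorem neg_neg_answers (S : Answers) : S.neg.neg = S := by
  apply Subtype.ext
  simp [Answers.neg, Set.image_image]

theorem StronglyReduces.dual {φ₁ φ₂ : PromiseProblem} (h : φ₁ ∝ φ₂) :
    PromiseHierarchy.dual φ₁ ∝ PromiseHierarchy.dual φ₂ := by
  obtain ⟨μ, hμ, h⟩ := h
  exact ⟨μ, hμ, fun s => Set.image_mono (h s)⟩

theorem dual_dual (φ : PromiseProblem) : dual (dual φ) = φ :=
  funext fun s => neg_neg_answers (φ s)

/-- One reduction suffices: a reduction of `dual φ` to `φ` is also one of `dual (dual φ) = φ` to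
`dual φ`. -/
theorem strongClosure_dual_eq {φ : PromiseProblem} (h : dual φ ∝ φ) :
    strongClosure (dual φ) = strongClosure φ := by
  have h' : φ ∝ dual φ := by
    have := h.dual
    rwa [dual_dual] at this
  ext ψ
  exact ⟨fun hψ => hψ.trans h, fun hψ => hψ.trans h'⟩

/-- A polynomial time computable map of instances yields a polynomial time computable map of
strings, which maps the strings that are not codes as a default instance. -/
theorem polyTime_map {ι κ : Type} {code : ι → Str} {code' : κ → Str} {f : ι → κ} {I₀ : ι}
    (hd : Nonempty (TM2ComputableInPolyTime (Subtype.val : Str → List Bool) (fun I => (code I).1)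
      (decode code I₀)))
    (hf : Nonempty (TM2ComputableInPolyTime (fun I => (code I).1) (fun J => (code' J).1) f)) :
    PolyTime fun s => code' (f (decode code I₀ s)) := by
  obtain ⟨h⟩ := computable_comp hd hf
  -- The same machine serves: encoding the instance on output and encoding its code as a string give
  -- the same list.
  exact ⟨⟨h.toTM2ComputableAux, h.time, h.outputsFun⟩⟩

theorem flip_involutive {m : ℕ} (i₀ : Fin m) :
    Function.Involutive fun x : Fin m → Bool => Function.update x i₀ (!x i₀) := by
  intro x
  simp

theorem eval_flip {m m' : ℕ} (hm : 0 < m) (f : BExpr (Fin m ⊕ Fin m')) (x : Fin m → Bool)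
    (y : Fin m' → Bool) : (f.bind (flipVar m m')).eval (Sum.elim x y) =
      f.eval (Sum.elim (Function.update x ⟨0, hm⟩ (!x ⟨0, hm⟩)) y) := by
  rw [BExpr.eval_bind]
  congr 1
  funext v
  rcases v with i | j
  · by_cases h : (i : ℕ) = 0
    · obtain rfl : i = ⟨0, hm⟩ := Fin.ext h
      simp [flipVar, BExpr.eval]
    · have : i ≠ ⟨0, hm⟩ := fun e => h (congrArg Fin.val e)
      simp [flipVar, BExpr.eval, h, this]
  · simp [flipVar, BExpr.eval]

/-- Flipping the first bit is a bijection of the candidates, so uniqueness is preserved, and the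
first bit of the witness is negated. -/
theorem uval₂_flip (I : Inst₂) :
    uval₂ I.flip.pos (fun x y => I.flip.f.eval (Sum.elim x y)) =
      (uval₂ I.pos fun x y => I.f.eval (Sum.elim x y)).neg := by
  obtain ⟨m, m', hm, f⟩ := I
  have hi := flip_involutive (⟨0, hm⟩ : Fin m)
  generalize hg : (fun x : Fin m → Bool => Function.update x ⟨0, hm⟩ (!x ⟨0, hm⟩)) = g at hi
  have hg₀ : ∀ x, g x ⟨0, hm⟩ = !x ⟨0, hm⟩ := fun x => by rw [← hg]; simp
  have he : ∀ x y, (f.bind (flipVar m m')).eval (Sum.elim x y) = f.eval (Sum.elim (g x) y) :=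
    fun x y => by rw [← hg]; exact eval_flip hm f x y
  have hu : (∃! x, ∀ y, f.eval (Sum.elim (g x) y) = true) ↔
      ∃! x, ∀ y, f.eval (Sum.elim x y) = true :=
    (hi.bijective.existsUnique_iff (p := fun x => ∀ y, f.eval (Sum.elim x y) = true)).symm
  apply Subtype.ext
  ext b
  simp only [uval₂, promise, Inst₂.flip, he, hu, Answers.neg, Set.mem_image, Set.mem_ofPred_eq]
  constructor
  · intro h
    refine ⟨!b, fun hp => ?_, by simp⟩
    obtain ⟨x, hx, rfl⟩ := h hp
    exact ⟨g x, hx, hg₀ x⟩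
  · rintro ⟨c, hc, rfl⟩ hp
    obtain ⟨x, hx, rfl⟩ := hc hp
    refine ⟨g x, ?_, hg₀ x⟩
    rwa [hi x]

theorem dual_UVAL₂_reduces : dual UVAL₂ ∝ UVAL₂ := by
  refine ⟨_, polyTime_map (computable_decode₂ ⟨1, 0, one_pos, .var (.inl 0)⟩) computable_flip,
    fun s => ?_⟩
  by_cases h : ∃ I, Inst₂.code I = s
  · obtain ⟨I, rfl⟩ := h
    rw [decode_code Inst₂.code_injective, UVAL₂_code, uval₂_flip, dual, UVAL₂_code]
  · rw [dual, show UVAL₂ s = anyAnswer from Function.extend_apply' _ _ _ h]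
    intro b _
    exact ⟨!b, trivial, by simp⟩

/-- Only a satisfiable `f` restricts the answer, and then its greatest solution is the unique `x`
that `UVAL₂` asks for. -/
theorem greatest_reduces (I : Inst₁) : (UVAL₂ I.greatest.code).1 ⊆ (MaxVAL I.code).1 := by
  obtain ⟨m, hm, f⟩ := I
  rw [UVAL₂_code, MaxVAL_code]
  have he : ∀ x : Fin m → Bool, (∀ y : Fin (m * (m - 1) / 2) → Bool,
      (conjunction f (List.finRange m)).eval (Sum.elim x y) = true) ↔ IsMaxSat f.eval x :=
    forall_greatest_iff f
  intro b hb hsat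
  simp only [uval₂, promise, Inst₁.greatest, he, Set.mem_ofPred_eq] at hb
  obtain ⟨x, hx⟩ := exists_isMaxSat hsat
  exact hb ⟨x, hx, fun y hy => toLex_inj.1 (hy.unique hx)⟩

theorem isStrongReduction_greatest (I₀ : Inst₁) : IsStrongReduction
    (fun s => (decode Inst₁.code I₀ s).greatest.code) MaxVAL UVAL₂ := by
  refine ⟨polyTime_map (computable_decode₁ I₀) computable_greatest, fun s => ?_⟩
  by_cases h : ∃ I, Inst₁.code I = s
  · obtain ⟨I, rfl⟩ := h
    simpa only [decode_code Inst₁.code_injective] using greatest_reduces I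
  · rw [show MaxVAL s = anyAnswer from Function.extend_apply' _ _ _ h]
    exact fun _ _ => trivial

theorem eval_guard {m : ℕ} (f : BExpr (Fin m)) (x : Fin (m + 1) → Bool) :
    (BExpr.or (.not (.var 0)) (f.bind fun i => .var i.succ)).eval x =
      (!x 0 || f.eval fun i => x i.succ) := by
  simp [BExpr.eval, BExpr.eval_bind]

open Classical in
-- All strings with leading bit 0 are solutions, and those with leading bit 1 are solutions iff the
-- rest satisfies `f`. As the leading bit is the most significant, it is 1 in the greatest solution
-- iff `f` is satisfiable.
theorem maxVal_guard (I : Inst₁) : maxVal I.guard.pos I.guard.f.eval =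
    onlyAnswer (decide (∃ x, I.f.eval x = true)) := by
  obtain ⟨m, hm, f⟩ := I
  have he : ∀ x : Fin (m + 1) → Bool, (Inst₁.guard ⟨m, hm, f⟩).f.eval x =
      (!x 0 || f.eval fun i => x i.succ) := eval_guard f
  have hsat : ∃ x, (Inst₁.guard ⟨m, hm, f⟩).f.eval x = true :=
    ⟨fun _ => false, (he fun _ => false).trans rfl⟩
  obtain ⟨x, hx⟩ : ∃ x : Fin (m + 1) → Bool, IsMaxSat (Inst₁.guard ⟨m, hm, f⟩).f.eval x :=
    exists_isMaxSat hsat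
  have hx₀ : x ⟨0, m.succ_pos⟩ = decide (∃ x, f.eval x = true) := by
    show x 0 = _
    have hx₁ : (!x 0 || f.eval fun i => x i.succ) = true := (he x).symm.trans hx.1
    cases h₀ : x 0 with
    | true =>
      rw [h₀] at hx₁
      exact (decide_eq_true ⟨_, by simpa using hx₁⟩).symm
    | false =>
      refine (decide_eq_false ?_).symm
      rintro ⟨z, hz⟩
      have hz' : (Inst₁.guard ⟨m, hm, f⟩).f.eval (Fin.cons true z : Fin (m + 1) → Bool) = true :=
        (he _).trans (by simpa using hz)
      have hle : toLex (Fin.cons true z : Fin (m + 1) → Bool) ≤ toLex x := hx.2 hz'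
      refine absurd hle (not_le.2 ⟨0, fun j hj => absurd hj (Fin.not_lt_zero j), ?_⟩)
      show x 0 < true
      rw [h₀]
      decide
  apply Subtype.ext
  ext b
  simp only [maxVal, promise, onlyAnswer, Set.mem_ofPred_eq, Set.mem_singleton_iff]
  constructor
  · intro h
    obtain ⟨z, hz, rfl⟩ := h hsat
    obtain rfl : z = x := toLex_inj.1 (hz.unique hx)
    exact hx₀
  · rintro rfl _
    exact ⟨x, hx, hx₀⟩

theorem SAT_reduces_MaxVAL : SAT ∝ MaxVAL := by
  -- For `SAT` the default matters: a string that is not a code must receive the answer 0, so `I₀`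
  -- is unsatisfiable.
  let I₀ : Inst₁ := ⟨1, one_pos, .and (.var 0) (.not (.var 0))⟩
  have hI₀ : ¬ ∃ x, I₀.f.eval x = true := by simp [I₀, BExpr.eval]
  refine ⟨_, polyTime_map (computable_decode₁ I₀) computable_guard, fun s => ?_⟩
  rw [MaxVAL_code, maxVal_guard]
  by_cases h : ∃ I, Inst₁.code I = s
  · obtain ⟨I, rfl⟩ := h
    rw [decode_code Inst₁.code_injective, SAT, Inst₁.code_injective.extend_apply]
  · rw [decode_of_not h, SAT, Function.extend_apply' _ _ _ h, decide_eq_false hI₀]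

end PromiseHierarchy

open PromiseHierarchy
theorem theorem2 :
    -- the class of problems reducible to `UVAL₂` is self-dual
    strongClosure (dual UVAL₂) = strongClosure UVAL₂ ∧
    -- `MaxVAL` strongly reduces to `UVAL₂`
    MaxVAL ∝ UVAL₂ ∧
    -- the reduction maps a code of `f(x)` to a code of the explicit `g(x, y)`, for which the only
    -- `x` with `g(x, y) = 1` for all `y` is the greatest satisfying assignment of `f`
    (∃ μ : Str → Str, IsStrongReduction μ MaxVAL UVAL₂ ∧
      ∀ (m : ℕ) (hm : 0 < m), ∃ e : Pairs m ≃ Fin (m * (m - 1) / 2),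
        ∀ f : BExpr (Fin m), ∃ g : BExpr (Fin m ⊕ Fin (m * (m - 1) / 2)),
          μ (Inst₁.code ⟨m, hm, f⟩) = Inst₂.code ⟨m, m * (m - 1) / 2, hm, g⟩ ∧
          (∀ (x : Fin m → Bool) (y : Fin (m * (m - 1) / 2) → Bool),
            g.eval (Sum.elim x y) = maxFormula f.eval x (y ∘ e)) ∧
          ∀ x : Fin m → Bool,
            (∀ y : Fin (m * (m - 1) / 2) → Bool, g.eval (Sum.elim x y) = true) ↔
              IsMaxSat f.eval x) ∧
    -- hence `SAT` strongly reduces to `UVAL₂`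
    SAT ∝ UVAL₂ := by
  -- Any default instance would do, as `MaxVAL` accepts every answer on strings that are not codes.
  have hred := isStrongReduction_greatest ⟨1, one_pos, .var 0⟩
  refine ⟨strongClosure_dual_eq dual_UVAL₂_reduces, ⟨_, hred⟩, ⟨_, hred, fun m hm =>
    ⟨pairIndex m, fun f => ⟨conjunction f (List.finRange m), ?_, eval_greatest f,
      forall_greatest_iff f⟩⟩⟩, SAT_reduces_MaxVAL.trans ⟨_, hred⟩⟩
  rw [decode_code Inst₁.code_injective]
  rfl
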